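/- **Setting.** On $\mathbb R^2$ (time $a_0$, space $a_1$) put $p\cdot a=p_0a_0-p_1a_1$, $W_{\mathrm R}=\{a: a_1>|a_0|\}$ and $V_+=\{p: p_0\ge |p_1|\}$. A *Borchers triple* $(\mathcal M,T,\Omega)$ on a complex Hilbert space $\mathcal H$ consists of a von Neumann algebra $\mathcal M\subset B(\mathcal H)$, a strongly continuous unitary representation $T$ of $\mathbb R^2$ on $\mathcal H$ and a vector $\Omega\in\mathcal H$ such that (1) $T(a)\mathcal M T(a)^*\subset\mathcal M$ for $a\in W_{\mathrm R}$; (2) the joint spectrum of $T$ (the support of the spectral measure $E$ with $T(a)=\int e^{ip\cdot a}\,dE(p)$) is contained in $V_+$; (3) $\Omega$ is cyclic and separating for $\mathcal M$. A unitary $V$ on $\mathcal H$ implements an *inner symmetry* of the triple if $V\mathcal MV^*=\mathcal M$, $V$ commutes with every $T(a)$, and $V\Omega=\Omega$; a group acts by inner symmetry if it is (strongly continuously) unitarily represented by such $V$'s. **Theorem.** Let $(\mathcal M_c,T_c,\Omega_c)$ be a Borchers triple on $\mathcal H_c$. 1. Let $V_c$ be an action of $S^1=\mathbb R/\mathbb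 Z$ by inner symmetry, and let $Q_c$ be its self-adjoint generator, $V_c(\kappa)=e^{i2\pi\kappa Q_c}$. For $\kappa\in\mathbb R$ put $\widetilde V_{c,\kappa}=e^{i2\pi\kappa\,Q_c\otimes Q_c}$ on the Hilbert space tensor product $\mathcal H_c\otimes\mathcal H_c$ and $$\widetilde{\mathcal M}_{c,\kappa}=\{x\otimes 1,\ \widetilde V_{c,\kappa}(1\otimes y)\widetilde V_{c,\kappa}^*: x,y\in\mathcal M_c\}''.$$ Then for every $\kappa\in\mathbb R$, $(\widetilde{\mathcal M}_{c,\kappa},\,T_c\otimes T_c,\,\Omega_c\otimes\Omega_c)$ is a Borchers triple. 2. Let $N\ge1$, let $V_c$ be an action of $\mathbb Z_N=\mathbb Z/N\mathbb Z$ by inner symmetry, and let $Q_c$ be any self-adjoint operator with $V_c(k)=e^{i\frac{2\pi k}{N}Q_c}$ for all $k\in\mathbb Z$. For $k\in\mathbb Z$ put $\widetilde V_{c,k}=e^{i\frac{2\pi k}{N}Q_c\otimes Q_c}$ and $$\widetilde{\mathcal M}_{c,k}=\{x\otimes 1,\ \widetilde V_{c,k}(1\otimes y)\widetilde V_{c,k}^*: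 x,y\in\mathcal M_c\}''.$$ Then for every $k\in\mathbb Z$, $(\widetilde{\mathcal M}_{c,k},\,T_c\otimes T_c,\,\Omega_c\otimes\Omega_c)$ is a Borchers triple. 3. If $T_c(a)\Omega_c=\Omega_c$ for all $a\in\mathbb R^2$, then $(T_c(a)\otimes T_c(a))(\Omega_c\otimes\Omega_c)=\Omega_c\otimes\Omega_c$ for all $a\in\mathbb R^2$. (In both cases the spectrum of $Q_c$ is automatically contained in $\mathbb Z$, because $e^{i2\pi Q_c}=1$.) -/

import Mathlib

open scoped TensorProduct ContDiff Topology

noncomputable section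

/-! ### Unitary representations, one-parameter groups and their generators -/

section Reps

variable {E : Type*} [NormedAddCommGroup E] [InnerProductSpace ℂ E] [CompleteSpace E]

/-- `U` is a strongly continuous unitary representation of the additive topological group `G`
on the Hilbert space `E`. -/
structure IsUnitaryRep {G : Type*} [AddCommGroup G] [TopologicalSpace G]
    (U : G → E →L[ℂ] E) : Prop where
  mem_unitary : ∀ g, U g ∈ unitary (E →L[ℂ] E)
  map_add : ∀ g h, U (g + h) = U g * U h
  strongly_continuous : ∀ ψ : E, Continuous fun g => U g ψ

/-- The generator `A` of a one-parameter group `U t = e^{itA}`: its domain consists of all `ψ` for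
which `t ↦ U t ψ` is differentiable at `0`, and `A ψ = -i (d/dt) U t ψ` at `t = 0`. -/
def oneParamGenerator (U : ℝ → E →L[ℂ] E) : E →ₗ.[ℂ] E where
  domain :=
    { carrier := {ψ | DifferentiableAt ℝ (fun t => U t ψ) 0}
      add_mem' := fun {ψ φ} hψ hφ => by
        simpa only [Set.mem_ofPred_eq, map_add] using DifferentiableAt.fun_add hψ hφ
      zero_mem' := by simp
      smul_mem' := fun c ψ hψ => by
        simpa only [Set.mem_ofPred_eq, map_smul] using DifferentiableAt.fun_const_smul hψ c }
  toFun :=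
    { toFun := fun ψ => -Complex.I • deriv (fun t => U t (ψ : E)) 0
      map_add' := fun ψ φ => by
        have h := deriv_fun_add (𝕜 := ℝ) (f := fun t => U t (ψ : E))
          (g := fun t => U t (φ : E)) (x := 0) ψ.2 φ.2
        simp only [Submodule.coe_add, map_add, h, smul_add]
      map_smul' := fun c ψ => by
        have h := deriv_fun_const_smul (𝕜 := ℝ) (f := fun t => U t (ψ : E)) (x := 0) c ψ.2
        simp only [Submodule.coe_smul, map_smul, h, RingHom.id_apply]
        rw [smul_comm] }

open Classical in
/-- The unitary operator `e^{itA}` for an essentially self-adjoint operator `A`: the value at `t` of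
the one-parameter unitary group whose generator extends `A`. By Stone's theorem this group exists;
since `A` has a unique self-adjoint extension (its closure), it is unique. -/
def expI (A : E →ₗ.[ℂ] E) (t : ℝ) : E →L[ℂ] E :=
  if h : ∃ U : ℝ → E →L[ℂ] E, IsUnitaryRep U ∧ A ≤ oneParamGenerator U then h.choose t else 1

/-- The von Neumann algebra generated by a set `S` of bounded operators, that is the double
commutant of `S ∪ S*` (which is `S''` when `S = S*`). -/
def generatedVonNeumannAlgebra (S : Set (E →L[ℂ] E)) : VonNeumannAlgebra E where
  toStarSubalgebra :=
    StarSubalgebra.centralizer ℂ (StarSubalgebra.centralizer ℂ S : Set (E →L[ℂ] E))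
  centralizer_centralizer' := by
    change Set.centralizer (Set.centralizer (Set.centralizer _)) = Set.centralizer _
    exact Set.centralizer_centralizer_centralizer _

end Reps

/-! ### Borchers triples in two spacetime dimensions -/

/-- Two-dimensional Minkowski space; the coordinate `a 0` is time and `a 1` is space. -/
abbrev Spacetime : Type := EuclideanSpace ℝ (Fin 2)

/-- The Minkowski product `p · a = p₀ a₀ - p₁ a₁`. -/
def minkowski (p a : Spacetime) : ℝ := p 0 * a 0 - p 1 * a 1

/-- The right wedge `{a | a₁ > |a₀|}`. -/
def rightWedge : Set Spacetime := {a | |a 0| < a 1}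

/-- The closed forward light cone `{p | p₀ ≥ |p₁|}`. -/
def forwardCone : Set Spacetime := {p | |p 1| ≤ p 0}

section Borchers

variable {H : Type*} [NormedAddCommGroup H] [InnerProductSpace ℂ H] [CompleteSpace H]

/-- The joint spectrum of a unitary representation `T` of the translations. Writing
`T a = ∫ e^{i p · a} dE(p)`, it is the support of `E`: a point `p` belongs to it iff every
neighbourhood of `p` supports a test function `h` with `∫ h dE ≠ 0`. Here
`(2π)² ∫ h dE = ∫ (∫ e^{-i q · a} h(q) dq) T a da`, integrated in the strong sense. -/
def jointSpectrum (T : Spacetime → H →L[ℂ] H) : Set Spacetime :=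
  {p | ∀ N ∈ 𝓝 p, ∃ h : Spacetime → ℂ,
    ContDiff ℝ ∞ h ∧ HasCompactSupport h ∧ tsupport h ⊆ N ∧
    ∃ ψ : H, ∫ a : Spacetime,
      (∫ q : Spacetime, Complex.exp (-Complex.I * (minkowski q a : ℂ)) * h q) • T a ψ ≠ 0}

/-- `(M, T, Ω)` is a Borchers triple. -/
structure IsBorchersTriple (M : VonNeumannAlgebra H) (T : Spacetime → H →L[ℂ] H) (Ω : H) :
    Prop where
  isUnitaryRep : IsUnitaryRep T
  wedge_covariant : ∀ a ∈ rightWedge, ∀ x ∈ M, T a * x * star (T a) ∈ M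
  spectrum_condition : jointSpectrum T ⊆ forwardCone
  cyclic : Dense {ψ : H | ∃ x ∈ M, x Ω = ψ}
  separating : ∀ x ∈ M, x Ω = 0 → x = 0

/-- The unitary `V` implements an inner symmetry of `(M, T, Ω)`: `Ad V` maps `M` onto `M`,
`V` commutes with the translations and `V` fixes `Ω`. -/
structure IsInnerSymmetry (M : VonNeumannAlgebra H) (T : Spacetime → H →L[ℂ] H) (Ω : H)
    (V : H →L[ℂ] H) : Prop where
  mem_unitary : V ∈ unitary (H →L[ℂ] H)
  preserves : ∀ x : H →L[ℂ] H, x ∈ M ↔ V * x * star V ∈ M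
  commutes : ∀ a, V * T a = T a * V
  fixes_vacuum : V Ω = Ω

end Borchers

/-! ### Hilbert space tensor products -/

section Tensor

variable (H : Type*) [NormedAddCommGroup H] [InnerProductSpace ℂ H]

/-- The Hilbert space tensor product of `H` with itself. -/
abbrev HilbertTensor : Type _ := UniformSpace.Completion (H ⊗[ℂ] H)

variable {H}

/-- The elementary tensor `ψ ⊗ φ`. -/
def vecTensor (ψ φ : H) : HilbertTensor H := ((ψ ⊗ₜ[ℂ] φ : H ⊗[ℂ] H) : HilbertTensor H)

/-- The bounded operator `x ⊗ y`. -/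
def opTensor (x y : H →L[ℂ] H) : HilbertTensor H →L[ℂ] HilbertTensor H :=
  (TensorProduct.mapL x y).completion

theorem opTensor_vecTensor (x y : H →L[ℂ] H) (ψ φ : H) :
    opTensor x y (vecTensor ψ φ) = vecTensor (x ψ) (y φ) := by
  simp [opTensor, vecTensor]

/-- The inclusion of the algebraic tensor product of two subspaces in the Hilbert space tensor
product. -/
def inclTensor (D D' : Submodule ℂ H) : D ⊗[ℂ] D' →ₗ[ℂ] HilbertTensor H :=
  (UniformSpace.Completion.toComplₗᵢ (𝕜 := ℂ) (E := H ⊗[ℂ] H)).toLinearMap ∘ₗ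
    TensorProduct.mapIncl D D'

theorem inclTensor_injective (D D' : Submodule ℂ H) : Function.Injective (inclTensor D D') := by
  rw [inclTensor, LinearMap.coe_comp]
  exact (UniformSpace.Completion.toComplₗᵢ (𝕜 := ℂ) (E := H ⊗[ℂ] H)).injective.comp
    (TensorProduct.map_injective_of_flat_flat _ _ D.subtype_injective D'.subtype_injective)

/-- The tensor product `A ⊗ B` of two densely defined operators, on the algebraic tensor product
of their domains. -/
def pmapTensor (A B : H →ₗ.[ℂ] H) : HilbertTensor H →ₗ.[ℂ] HilbertTensor H where
  domain := LinearMap.range (inclTensor A.domain B.domain)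
  toFun :=
    ((UniformSpace.Completion.toComplₗᵢ (𝕜 := ℂ) (E := H ⊗[ℂ] H)).toLinearMap ∘ₗ
      TensorProduct.map A.toFun B.toFun) ∘ₗ
    (LinearEquiv.ofInjective _ (inclTensor_injective A.domain B.domain)).symm.toLinearMap

theorem pmapTensor_apply (A B : H →ₗ.[ℂ] H) (ψ : A.domain) (φ : B.domain)
    (h : vecTensor (ψ : H) (φ : H) ∈ (pmapTensor A B).domain) :
    pmapTensor A B ⟨vecTensor (ψ : H) (φ : H), h⟩ = vecTensor (A ψ) (B φ) := by
  have : (⟨vecTensor (ψ : H) (φ : H), h⟩ : LinearMap.range (inclTensor A.domain B.domain)) =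
      LinearEquiv.ofInjective _ (inclTensor_injective A.domain B.domain) (ψ ⊗ₜ φ) := rfl
  change ((UniformSpace.Completion.toComplₗᵢ (𝕜 := ℂ) (E := H ⊗[ℂ] H)).toLinearMap ∘ₗ
      TensorProduct.map A.toFun B.toFun)
    ((LinearEquiv.ofInjective _ (inclTensor_injective A.domain B.domain)).symm
      ⟨vecTensor (ψ : H) (φ : H), h⟩) = _
  rw [this, LinearEquiv.symm_apply_apply]
  rfl

variable [CompleteSpace H]

/-- The von Neumann algebra `{x ⊗ 1, Ad W (1 ⊗ y) : x, y ∈ M}''` for a unitary `W`. -/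
def twistedAlgebra (M : VonNeumannAlgebra H) (W : HilbertTensor H →L[ℂ] HilbertTensor H) :
    VonNeumannAlgebra (HilbertTensor H) :=
  generatedVonNeumannAlgebra
    ({z | ∃ x ∈ M, z = opTensor x 1} ∪ {z | ∃ y ∈ M, z = W * opTensor 1 y * star W})

end Tensor

end

/-!
Write `W = e^{isQ ⊗ Q}` for the twist. In both cases of the theorem `U t = e^{itQ}` is `2π`-periodic,
so `H` has an orthonormal basis `e` of eigenvectors of `Q`, with integer eigenvalues `n i`
(`exists_weight_basis`). Then `e i ⊗ e j` is an eigenbasis of `Q ⊗ Q`, and this determines `W`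
(`expI_pmapTensor`): it acts as `U (s * n i)` on one tensor factor when the other one is `e i`. The
operators `Y i = U (s * n i)` are inner symmetries, although in the case of `ℤ/Nℤ` a general `U t`
need not be one. All that is used of `W` is therefore that it is unitary and has both forms
`∑ Y i ⊗ |e i⟩⟨e i|` and `∑ |e i⟩⟨e i| ⊗ Y i` (`isBorchersTriple_twistedAlgebra`).

* `W` commutes with `T a ⊗ 1` and `1 ⊗ T a`, so the translations act on the twisted algebra as on
  `x ⊗ 1` and `1 ⊗ y`, which gives covariance. Moreover `W (Ω ⊗ φ) = Ω ⊗ φ` and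
  `W (ψ ⊗ Ω) = ψ ⊗ Ω`, so that the twisted algebra maps `Ω ⊗ Ω` onto all `x Ω ⊗ y Ω`, and `Ω ⊗ Ω` is
  cyclic.
* The commutant of the twisted algebra contains `1 ⊗ y'` and `W (x' ⊗ 1) W*` for `x', y' ∈ M'`, since
  `Y i M' (Y i)* = M'`. As `Ω` is separating for `M`, it is cyclic for `M'`
  (`VonNeumannAlgebra.dense_commutant_of_separating`), hence `Ω ⊗ Ω` is cyclic for the commutant of
  the twisted algebra, that is separating for the algebra.
* The spectrum condition does not involve `W`. The forward cone is the intersection of two half-planes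
  `l ≥ 0`. Let `h` be a test function supported in `l < -2 ε`. Vectors `ψ` which are smeared with test
  functions `g` supported in `l ≥ -ε` are total, and on `ψ ⊗ φ` the smearing of `T ⊗ T` with `h`
  reduces to smearing `T` on `φ` with correlations of `g` and `h` (`smear_opTensor_smear`). These are
  supported in `l ≤ -ε`, so the result is zero (`jointSpectrum_opTensor_subset`).
-/

noncomputable section

/-! ### The Hilbert space tensor product -/

section TensorBasics

variable {H : Type*} [NormedAddCommGroup H] [InnerProductSpace ℂ H]

/-- The elementary tensor `ψ ⊗ φ` as a continuous bilinear map. -/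
def vecTensorL (H : Type*) [NormedAddCommGroup H] [InnerProductSpace ℂ H] :
    H →L[ℂ] H →L[ℂ] HilbertTensor H :=
  LinearMap.mkContinuous₂
    ((TensorProduct.mk ℂ H H).compr₂
      (UniformSpace.Completion.toComplₗᵢ (𝕜 := ℂ) (E := H ⊗[ℂ] H)).toLinearMap) 1
    fun x y => by simp

theorem vecTensorL_apply (ψ φ : H) : vecTensorL H ψ φ = vecTensor ψ φ := rfl

theorem inner_vecTensor (ψ φ ψ' φ' : H) :
    inner ℂ (vecTensor ψ φ) (vecTensor ψ' φ') = inner ℂ ψ ψ' * inner ℂ φ φ' := by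
  simp [vecTensor, UniformSpace.Completion.inner_coe]

theorem vecTensor_smul_left (c : ℂ) (ψ φ : H) : vecTensor (c • ψ) φ = c • vecTensor ψ φ := by
  simp [← vecTensorL_apply]

theorem vecTensor_smul_right (c : ℂ) (ψ φ : H) : vecTensor ψ (c • φ) = c • vecTensor ψ φ := by
  simp [← vecTensorL_apply]

/-- Bounded operators on the Hilbert tensor product are determined by elementary tensors. -/
theorem HilbertTensor.clm_ext {F : Type*} [NormedAddCommGroup F] [NormedSpace ℂ F]
    {A B : HilbertTensor H →L[ℂ] F}
    (h : ∀ ψ φ, A (vecTensor ψ φ) = B (vecTensor ψ φ)) : A = B := by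
  ext z
  refine UniformSpace.Completion.induction_on z (isClosed_eq A.continuous B.continuous) fun z => ?_
  induction z with
  | zero => rw [UniformSpace.Completion.coe_zero, map_zero, map_zero]
  | tmul x y => exact h x y
  | add x y hx hy => rw [UniformSpace.Completion.coe_add, map_add, map_add, hx, hy]

theorem clm_ext_right {ι F : Type*} [NormedAddCommGroup F] [NormedSpace ℂ F]
    (e : HilbertBasis ι ℂ H) {A B : HilbertTensor H →L[ℂ] F}
    (h : ∀ ψ i, A (vecTensor ψ (e i)) = B (vecTensor ψ (e i))) : A = B := by
  refine HilbertTensor.clm_ext fun ψ φ => ?_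
  refine DFunLike.congr_fun (f := A ∘L vecTensorL H ψ) (g := B ∘L vecTensorL H ψ) ?_ φ
  refine ContinuousLinearMap.ext_on
    ((Submodule.dense_iff_topologicalClosure_eq_top).2 e.dense_span) ?_
  rintro _ ⟨i, rfl⟩
  exact h ψ i

theorem clm_ext_left {ι F : Type*} [NormedAddCommGroup F] [NormedSpace ℂ F]
    (e : HilbertBasis ι ℂ H) {A B : HilbertTensor H →L[ℂ] F}
    (h : ∀ i φ, A (vecTensor (e i) φ) = B (vecTensor (e i) φ)) : A = B := by
  refine HilbertTensor.clm_ext fun ψ φ => ?_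
  refine DFunLike.congr_fun (f := A ∘L (vecTensorL H).flip φ)
    (g := B ∘L (vecTensorL H).flip φ) ?_ ψ
  refine ContinuousLinearMap.ext_on
    ((Submodule.dense_iff_topologicalClosure_eq_top).2 e.dense_span) ?_
  rintro _ ⟨i, rfl⟩
  exact h i φ

theorem clm_ext_basis {ι F : Type*} [NormedAddCommGroup F] [NormedSpace ℂ F]
    (e : HilbertBasis ι ℂ H) {A B : HilbertTensor H →L[ℂ] F}
    (h : ∀ i j, A (vecTensor (e i) (e j)) = B (vecTensor (e i) (e j))) : A = B := by
  refine clm_ext_left e fun i φ => ?_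
  refine DFunLike.congr_fun (f := A ∘L vecTensorL H (e i)) (g := B ∘L vecTensorL H (e i)) ?_ φ
  refine ContinuousLinearMap.ext_on
    ((Submodule.dense_iff_topologicalClosure_eq_top).2 e.dense_span) ?_
  rintro _ ⟨j, rfl⟩
  exact h i j

theorem opTensor_mul (x y x' y' : H →L[ℂ] H) :
    opTensor (x * x') (y * y') = opTensor x y * opTensor x' y' :=
  HilbertTensor.clm_ext fun ψ φ => by
    simp only [opTensor_vecTensor, mul_apply_eq_comp]

theorem opTensor_one : opTensor (1 : H →L[ℂ] H) 1 = 1 :=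
  HilbertTensor.clm_ext fun ψ φ => by
    simp only [opTensor_vecTensor, one_apply_eq_self]

/-- The set of elementary tensors built from two dense sets spans a dense subspace. -/
theorem dense_of_vecTensor_mem {D D' : Set H} (hD : Dense D) (hD' : Dense D')
    (S : Submodule ℂ (HilbertTensor H)) (h : ∀ ψ ∈ D, ∀ φ ∈ D', vecTensor ψ φ ∈ S) :
    Dense (S : Set (HilbertTensor H)) := by
  have hc : IsClosed (S.topologicalClosure : Set (HilbertTensor H)) :=
    S.isClosed_topologicalClosure
  have h1 : ∀ ψ ∈ D, ∀ φ, vecTensor ψ φ ∈ S.topologicalClosure := fun ψ hψ φ =>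
    hD'.induction (P := fun φ => vecTensor ψ φ ∈ S.topologicalClosure)
      (fun φ hφ => S.le_topologicalClosure (h ψ hψ φ hφ))
      (hc.preimage (vecTensorL H ψ).continuous) φ
  have h2 : ∀ ψ φ, vecTensor ψ φ ∈ S.topologicalClosure := fun ψ φ =>
    hD.induction (P := fun ψ => vecTensor ψ φ ∈ S.topologicalClosure)
      (fun ψ hψ => h1 ψ hψ φ)
      (hc.preimage ((vecTensorL H).flip φ).continuous) ψ
  rw [Submodule.dense_iff_topologicalClosure_eq_top, eq_top_iff]
  rintro z -
  refine UniformSpace.Completion.induction_on z hc fun z => ?_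
  induction z with
  | zero => exact S.topologicalClosure.zero_mem
  | tmul x y => exact h2 x y
  | add x y hx hy =>
    rw [UniformSpace.Completion.coe_add]
    exact add_mem hx hy

/-- The tensor products of the vectors of a Hilbert basis form a Hilbert basis. -/
def HilbertBasis.tensor {ι : Type*} (e : HilbertBasis ι ℂ H) :
    HilbertBasis (ι × ι) ℂ (HilbertTensor H) :=
  HilbertBasis.mkOfOrthogonalEqBot (v := fun p : ι × ι => vecTensor (e p.1) (e p.2))
    (by
      classical
      rw [orthonormal_iff_ite]
      rintro ⟨i, j⟩ ⟨i', j'⟩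
      simp only [inner_vecTensor, orthonormal_iff_ite.1 e.orthonormal, Prod.mk.injEq]
      split_ifs <;> simp_all)
    (by
      rw [Submodule.eq_bot_iff]
      intro v hv
      have : innerSL ℂ v = 0 := clm_ext_basis e fun i j =>
        (Submodule.mem_orthogonal' _ _).1 hv _ (Submodule.subset_span ⟨(i, j), rfl⟩)
      exact inner_self_eq_zero.1 (DFunLike.congr_fun this v))

theorem HilbertBasis.tensor_apply {ι : Type*} (e : HilbertBasis ι ℂ H) (p : ι × ι) :
    e.tensor p = vecTensor (e p.1) (e p.2) := by
  simp [HilbertBasis.tensor]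

variable [CompleteSpace H]

theorem star_opTensor (x y : H →L[ℂ] H) : star (opTensor x y) = opTensor (star x) (star y) := by
  refine HilbertTensor.clm_ext fun ψ φ => ?_
  rw [← sub_eq_zero, ← inner_self_eq_zero (𝕜 := ℂ)]
  suffices h : innerSL ℂ (star (opTensor x y) (vecTensor ψ φ) -
      opTensor (star x) (star y) (vecTensor ψ φ)) = 0 from DFunLike.congr_fun h _
  refine HilbertTensor.clm_ext fun ψ' φ' => ?_
  simp only [innerSL_apply_apply, inner_sub_left, ContinuousLinearMap.star_eq_adjoint,
    ContinuousLinearMap.adjoint_inner_left, opTensor_vecTensor, inner_vecTensor, sub_self,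
    zero_apply]

theorem opTensor_mem_unitary {x y : H →L[ℂ] H} (hx : x ∈ unitary (H →L[ℂ] H))
    (hy : y ∈ unitary (H →L[ℂ] H)) :
    opTensor x y ∈ unitary (HilbertTensor H →L[ℂ] HilbertTensor H) := by
  rw [Unitary.mem_iff] at *
  rw [star_opTensor, ← opTensor_mul, ← opTensor_mul, hx.1, hx.2, hy.1, hy.2, opTensor_one]
  exact ⟨rfl, rfl⟩

end TensorBasics

/-! ### Unitary operators and unitary representations -/

/-- A family of isometries is strongly continuous as soon as it is so on a dense subspace. -/
theorem strongly_continuous_of_dense_span {E X : Type*} [NormedAddCommGroup E]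
    [InnerProductSpace ℂ E] [TopologicalSpace X] {A : X → E →L[ℂ] E}
    (hA : ∀ x ψ, ‖A x ψ‖ = ‖ψ‖) {D : Set E}
    (hD : (Submodule.span ℂ D).topologicalClosure = ⊤) (h : ∀ ψ ∈ D, Continuous fun x => A x ψ)
    (ψ : E) : Continuous fun x => A x ψ := by
  have hspan : ∀ φ ∈ Submodule.span ℂ D, Continuous fun x => A x φ := by
    intro φ hφ
    induction hφ using Submodule.span_induction with
    | mem φ hφ => exact h φ hφ
    | zero => simpa using continuous_const
    | add φ χ _ _ h1 h2 => simp only [map_add]; exact h1.add h2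
    | smul c φ _ h1 => simp only [map_smul]; exact h1.const_smul c
  rw [← Submodule.dense_iff_topologicalClosure_eq_top] at hD
  rw [Metric.continuous_iff']
  intro a ε hε
  obtain ⟨φ, hφ, hφε⟩ := hD.exists_dist_lt ψ (ε := ε / 3) (by positivity)
  filter_upwards [Metric.continuous_iff'.1 (hspan φ hφ) a (ε / 3) (by positivity)] with x hx
  have key : ∀ y, dist (A y ψ) (A y φ) < ε / 3 := fun y => by
    rwa [dist_eq_norm, ← map_sub, hA, ← dist_eq_norm]
  have := dist_triangle4 (A x ψ) (A x φ) (A a φ) (A a ψ)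
  have h3 := key a
  rw [dist_comm] at h3
  linarith [key x]

section UnitaryGroups

variable {E : Type*} [NormedAddCommGroup E] [InnerProductSpace ℂ E] [CompleteSpace E]

theorem norm_apply_of_mem_unitary {u : E →L[ℂ] E} (hu : u ∈ unitary (E →L[ℂ] E)) (ψ : E) :
    ‖u ψ‖ = ‖ψ‖ :=
  (ContinuousLinearMap.norm_map_iff_adjoint_comp_self u).2 (Unitary.star_mul_self_of_mem hu) ψ

theorem inner_apply_of_mem_unitary {u : E →L[ℂ] E} (hu : u ∈ unitary (E →L[ℂ] E)) (ψ φ : E) :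
    inner ℂ (u ψ) (u φ) = inner ℂ ψ φ :=
  (ContinuousLinearMap.inner_map_map_iff_adjoint_comp_self u).2
    (Unitary.star_mul_self_of_mem hu) ψ φ

section IsUnitaryRep

variable {G : Type*} [AddCommGroup G] [TopologicalSpace G] {U : G → E →L[ℂ] E}

theorem IsUnitaryRep.map_zero (hU : IsUnitaryRep U) : U 0 = 1 := by
  have h : U 0 = U 0 * U 0 := by rw [← hU.map_add, add_zero]
  have h' := Unitary.star_mul_self_of_mem (hU.mem_unitary 0)
  calc U 0 = star (U 0) * U 0 * U 0 := by rw [h', one_mul]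
    _ = 1 := by rw [mul_assoc, ← h, h']

theorem IsUnitaryRep.star_eq (hU : IsUnitaryRep U) (g : G) : star (U g) = U (-g) := by
  have h : U g * U (-g) = 1 := by rw [← hU.map_add, add_neg_cancel, hU.map_zero]
  calc star (U g) = star (U g) * (U g * U (-g)) := by rw [h, mul_one]
    _ = U (-g) := by rw [← mul_assoc, Unitary.star_mul_self_of_mem (hU.mem_unitary g), one_mul]

theorem IsUnitaryRep.norm_apply (hU : IsUnitaryRep U) (g : G) (ψ : E) : ‖U g ψ‖ = ‖ψ‖ :=
  norm_apply_of_mem_unitary (hU.mem_unitary g) ψ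

theorem IsUnitaryRep.add_apply (hU : IsUnitaryRep U) (g h : G) (ψ : E) :
    U (g + h) ψ = U g (U h ψ) := by rw [hU.map_add]; rfl

theorem IsUnitaryRep.inner_apply_left (hU : IsUnitaryRep U) (g : G) (ψ φ : E) :
    inner ℂ (U g ψ) φ = inner ℂ ψ (U (-g) φ) := by
  rw [← hU.star_eq, ContinuousLinearMap.star_eq_adjoint, ContinuousLinearMap.adjoint_inner_right]

end IsUnitaryRep

theorem IsUnitaryRep.opTensor {G : Type*} [AddCommGroup G] [TopologicalSpace G]
    {U : G → E →L[ℂ] E} (hU : IsUnitaryRep U) : IsUnitaryRep fun g => opTensor (U g) (U g) where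
  mem_unitary g := opTensor_mem_unitary (hU.mem_unitary g) (hU.mem_unitary g)
  map_add g h := by rw [hU.map_add, opTensor_mul]
  strongly_continuous := by
    refine strongly_continuous_of_dense_span
      (D := Set.range fun p : E × E => vecTensor p.1 p.2)
      (fun g => norm_apply_of_mem_unitary
        (opTensor_mem_unitary (hU.mem_unitary g) (hU.mem_unitary g))) ?_ ?_
    · rw [← Submodule.dense_iff_topologicalClosure_eq_top]
      exact dense_of_vecTensor_mem dense_univ dense_univ _
        fun ψ _ φ _ => Submodule.subset_span ⟨(ψ, φ), rfl⟩
    · rintro _ ⟨⟨ψ, φ⟩, rfl⟩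
      simp only [opTensor_vecTensor]
      exact ((vecTensorL E).continuous.comp (hU.strongly_continuous ψ)).clm_apply
        (hU.strongly_continuous φ)

end UnitaryGroups

/-! ### One-parameter unitary groups and their generators -/

section Generators

open Complex

variable {E : Type*} [NormedAddCommGroup E] [InnerProductSpace ℂ E]

theorem HilbertBasis.eq_of_inner_eq {ι : Type*} (b : HilbertBasis ι ℂ E) {x y : E}
    (h : ∀ i, inner ℂ (b i) x = inner ℂ (b i) y) : x = y :=
  b.repr.injective <| by
    ext i
    rw [b.repr_apply_apply, b.repr_apply_apply, h]

theorem HilbertBasis.clm_ext {ι F : Type*} [NormedAddCommGroup F] [NormedSpace ℂ F]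
    (b : HilbertBasis ι ℂ E) {A B : E →L[ℂ] F} (h : ∀ i, A (b i) = B (b i)) : A = B :=
  ContinuousLinearMap.ext_on ((Submodule.dense_iff_topologicalClosure_eq_top).2 b.dense_span)
    (by rintro _ ⟨i, rfl⟩; exact h i)

theorem norm_exp_I_mul_mul (t l : ℝ) : ‖exp (I * t * l)‖ = 1 := by
  rw [mul_assoc, mul_comm, ← ofReal_mul, norm_exp_ofReal_mul_I]

theorem oneParamGenerator_hasDerivAt (U : ℝ → E →L[ℂ] E) (ψ : (oneParamGenerator U).domain) :
    HasDerivAt (fun t => U t (ψ : E)) (I • oneParamGenerator U ψ) 0 := by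
  have h : DifferentiableAt ℝ (fun t => U t (ψ : E)) 0 := ψ.2
  convert h.hasDerivAt using 1
  change I • (-I • deriv (fun t => U t (ψ : E)) 0) = _
  rw [smul_smul]
  simp

theorem oneParamGenerator_of_hasDerivAt {U : ℝ → E →L[ℂ] E} {ψ ξ : E}
    (h : HasDerivAt (fun t => U t ψ) (I • ξ) 0) :
    ∃ hψ : ψ ∈ (oneParamGenerator U).domain, oneParamGenerator U ⟨ψ, hψ⟩ = ξ := by
  refine ⟨h.differentiableAt, ?_⟩
  change -I • deriv (fun t => U t ψ) 0 = ξ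
  rw [h.deriv, smul_smul]
  simp

variable [CompleteSpace E]

/-- The unitary operator which multiplies the vectors of a Hilbert basis by phases: it maps the
basis to another Hilbert basis. -/
theorem HilbertBasis.exists_unitary_diagonal {ι : Type*} (b : HilbertBasis ι ℂ E) (c : ι → ℂ)
    (hc : ∀ i, ‖c i‖ = 1) :
    ∃ u ∈ unitary (E →L[ℂ] E), ∀ i, u (b i) = c i • b i := by
  classical
  have hon : Orthonormal ℂ fun i => c i • b i := by
    rw [orthonormal_iff_ite]
    intro i j
    rw [inner_smul_left, inner_smul_right, orthonormal_iff_ite.1 b.orthonormal]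
    split_ifs with h
    · subst h
      rw [mul_one, mul_comm, mul_conj, normSq_eq_norm_sq, hc]
      simp
    · simp
  have hperp : (Submodule.span ℂ (Set.range fun i => c i • b i))ᗮ = ⊥ := by
    rw [Submodule.eq_bot_iff]
    intro v hv
    refine b.eq_of_inner_eq fun i => ?_
    have h := (Submodule.mem_orthogonal _ _).1 hv _ (Submodule.subset_span ⟨i, rfl⟩)
    rw [inner_smul_left, mul_eq_zero] at h
    rw [inner_zero_right]
    refine h.resolve_left fun h0 => ?_
    have := hc i
    rw [map_eq_zero] at h0
    simp [h0] at this
  let b' := HilbertBasis.mkOfOrthogonalEqBot hon hperp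
  have hb' : ∀ i, b' i = c i • b i := fun i => by simp [b']
  refine ⟨_, (Unitary.linearIsometryEquiv.symm (b.repr.trans b'.repr.symm)).2, fun i => ?_⟩
  rw [← hb']
  change b'.repr.symm (b.repr (b i)) = b' i
  rw [b.repr_self, b'.repr_symm_single]

/-- The one-parameter unitary group with given eigenvectors and eigenvalues. -/
theorem HilbertBasis.exists_isUnitaryRep_diagonal {ι : Type*} (b : HilbertBasis ι ℂ E)
    (l : ι → ℝ) :
    ∃ W : ℝ → E →L[ℂ] E, IsUnitaryRep W ∧ ∀ t i, W t (b i) = exp (I * t * l i) • b i := by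
  choose W hW hWb using fun t : ℝ => b.exists_unitary_diagonal (fun i => exp (I * t * l i))
    fun i => norm_exp_I_mul_mul t (l i)
  refine ⟨W, ⟨hW, fun s t => b.clm_ext fun i => ?_, ?_⟩, hWb⟩
  · rw [mul_apply_eq_comp, hWb, hWb, map_smul, hWb, smul_smul, ← exp_add]
    push_cast
    ring_nf
  · refine strongly_continuous_of_dense_span (fun t => norm_apply_of_mem_unitary (hW t))
      b.dense_span ?_
    rintro _ ⟨i, rfl⟩
    simp only [hWb]
    fun_prop

/-- An eigenvector of the generator is an eigenvector of the one-parameter group. -/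
theorem IsUnitaryRep.apply_of_hasDerivAt {U : ℝ → E →L[ℂ] E} (hU : IsUnitaryRep U) {ψ : E} {l : ℝ}
    (h : HasDerivAt (fun t => U t ψ) (I • (l : ℂ) • ψ) 0) (t : ℝ) :
    U t ψ = exp (I * t * l) • ψ := by
  have h1 : ∀ s, HasDerivAt (fun t => U t ψ) ((I * l) • U s ψ) s := by
    intro s
    have h2 := (((U s).restrictScalars ℝ).hasFDerivAt (x := U 0 ψ)).comp_hasDerivAt (0 : ℝ) h
    have h3 : HasDerivAt (fun t => U s (U (t - s) ψ)) ((I * l) • U s ψ) s := by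
      have h4 := HasDerivAt.scomp_of_eq (x := s) (h := fun t => t - s) (h' := 1)
        h2 ((hasDerivAt_id s).sub_const s) (by simp)
      simpa only [smul_smul, Function.comp_def, ContinuousLinearMap.coe_restrictScalars', map_smul,
        one_smul] using h4
    refine h3.congr_of_eventuallyEq (Filter.Eventually.of_forall fun t => ?_)
    change U t ψ = U s (U (t - s) ψ)
    rw [← hU.add_apply, add_sub_cancel]
  have hexp : ∀ s : ℝ, HasDerivAt (fun t : ℝ => exp (-(I * t * l)))
      (exp (-(I * s * l)) * -(I * l)) s := by
    intro s
    have : HasDerivAt (fun t : ℝ => I * t * l) (I * l) s := by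
      simpa using ((hasDerivAt_id s).ofReal_comp.const_mul I).mul_const (l : ℂ)
    exact this.fun_neg.cexp
  have h5 : ∀ s, HasDerivAt (fun t : ℝ => exp (-(I * t * l)) • U t ψ) 0 s := by
    intro s
    refine ((hexp s).fun_smul (h1 s)).congr_deriv ?_
    rw [smul_smul, ← add_smul, mul_neg, add_neg_cancel, zero_smul]
  have h6 := is_const_of_deriv_eq_zero (fun s => (h5 s).differentiableAt) (fun s => (h5 s).deriv)
    t 0
  simp only [ofReal_zero, mul_zero, zero_mul, neg_zero, exp_zero, one_smul, hU.map_zero,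
    one_apply_eq_self] at h6
  nth_rewrite 2 [← h6]
  rw [smul_smul, ← exp_add, add_neg_cancel, exp_zero, one_smul]

/-- For the one-parameter group `W` with eigenbasis `b`, membership in the domain of the generator
can be tested on the expansion coefficients. -/
theorem IsUnitaryRep.hasDerivAt_of_coefficients {ι : Type*} {W : ℝ → E →L[ℂ] E}
    (hW : IsUnitaryRep W) (b : HilbertBasis ι ℂ E) (l : ι → ℝ)
    (hb : ∀ t i, W t (b i) = exp (I * t * l i) • b i) {η ξ : E}
    (h : ∀ i, inner ℂ (b i) ξ = l i * inner ℂ (b i) η) :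
    HasDerivAt (fun t => W t η) (I • ξ) 0 := by
  have hcoef : ∀ (t : ℝ) (i : ι) (v : E), inner ℂ (b i) (W t v) =
      exp (I * t * l i) * inner ℂ (b i) v := by
    intro t i v
    have := hW.inner_apply_left (-t) (b i) v
    rw [neg_neg] at this
    rw [← this, hb, inner_smul_left, ← exp_conj]
    simp
  have hcont : Continuous fun s => I • W s ξ := (hW.strongly_continuous ξ).const_smul I
  -- the integrated form `W t η - η = ∫₀ᵗ i W s ξ ds`, checked on coefficients
  have key : ∀ t, W t η = η + ∫ s in (0 : ℝ)..t, I • W s ξ := by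
    intro t
    refine b.eq_of_inner_eq fun i => ?_
    rw [inner_add_right, ← innerSL_apply_apply (𝕜 := ℂ) (b i) (∫ s in (0 : ℝ)..t, _),
      ← ContinuousLinearMap.intervalIntegral_comp_comm _ (hcont.intervalIntegrable _ _)]
    have hd : ∀ s ∈ Set.uIcc 0 t, HasDerivAt
        (fun s : ℝ => exp (I * s * l i) * inner ℂ (b i) η)
        (innerSL ℂ (b i) (I • W s ξ)) s := by
      intro s _
      have : HasDerivAt (fun t : ℝ => I * t * l i) (I * l i) s := by
        simpa using ((hasDerivAt_id s).ofReal_comp.const_mul I).mul_const (l i : ℂ)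
      refine ((this.cexp).mul_const (inner ℂ (b i) η)).congr_deriv ?_
      rw [map_smul, innerSL_apply_apply, hcoef, h, smul_eq_mul]
      ring
    rw [intervalIntegral.integral_eq_sub_of_hasDerivAt hd
      (((innerSL ℂ (b i)).continuous.comp hcont).intervalIntegrable _ _), hcoef]
    simp
  have hd := (intervalIntegral.integral_hasDerivAt_right (hcont.intervalIntegrable 0 0)
    (hcont.stronglyMeasurableAtFilter _ _) hcont.continuousAt).const_add η
  rw [hW.map_zero, one_apply_eq_self] at hd
  exact hd.congr_of_eventuallyEq (Filter.Eventually.of_forall key)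

theorem isUnitaryRep_expI {A : E →ₗ.[ℂ] E}
    (h : ∃ U : ℝ → E →L[ℂ] E, IsUnitaryRep U ∧ A ≤ oneParamGenerator U) :
    IsUnitaryRep (expI A) ∧ A ≤ oneParamGenerator (expI A) := by
  have : expI A = h.choose := by
    funext t
    rw [expI, dif_pos h]
  rw [this]
  exact h.choose_spec

end Generators

/-! ### Periodic one-parameter groups -/

section Weights

open Complex

variable {H : Type*} [NormedAddCommGroup H] [InnerProductSpace ℂ H]

/-- The vectors of weight `n` for a `2π`-periodic one-parameter group. -/
def weightSpace (U : ℝ → H →L[ℂ] H) (n : ℤ) : Submodule ℂ H where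
  carrier := {ψ | ∀ t, U t ψ = exp (I * t * (n : ℝ)) • ψ}
  add_mem' h h' t := by rw [map_add, h t, h' t, smul_add]
  zero_mem' t := by simp
  smul_mem' c ψ h t := by rw [map_smul, h t, smul_comm]

theorem mem_weightSpace {U : ℝ → H →L[ℂ] H} {n : ℤ} {ψ : H} :
    ψ ∈ weightSpace U n ↔ ∀ t, U t ψ = exp (I * t * (n : ℝ)) • ψ := Iff.rfl

theorem isClosed_weightSpace (U : ℝ → H →L[ℂ] H) (n : ℤ) :
    IsClosed (weightSpace U n : Set H) := by
  have : (weightSpace U n : Set H) = ⋂ t, {ψ | U t ψ = exp (I * t * (n : ℝ)) • ψ} := by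
    ext; simp [mem_weightSpace]
  rw [this]
  exact isClosed_iInter fun t => isClosed_eq (U t).continuous (continuous_const_smul _)

theorem pmapTensor_inclTensor (A B : H →ₗ.[ℂ] H) (z : A.domain ⊗[ℂ] B.domain) :
    pmapTensor A B (LinearEquiv.ofInjective _ (inclTensor_injective A.domain B.domain) z) =
      ((TensorProduct.map A.toFun B.toFun z : H ⊗[ℂ] H) : HilbertTensor H) := by
  change ((UniformSpace.Completion.toComplₗᵢ (𝕜 := ℂ) (E := H ⊗[ℂ] H)).toLinearMap ∘ₗ
      TensorProduct.map A.toFun B.toFun)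
    ((LinearEquiv.ofInjective _ (inclTensor_injective A.domain B.domain)).symm _) = _
  rw [LinearEquiv.symm_apply_apply]
  rfl

/-- If `Q` has the eigenbasis `e`, then `Q ⊗ Q` on the algebraic tensor product of the domains acts
on expansion coefficients with respect to `e ⊗ e` as multiplication by the products of the
eigenvalues. -/
theorem inner_pmapTensor {ι : Type*} (e : HilbertBasis ι ℂ H) {n : ι → ℝ} {Q : H →ₗ.[ℂ] H}
    (hQ : ∀ i (ψ : Q.domain), inner ℂ (e i) (Q ψ) = n i * inner ℂ (e i) (ψ : H)) (p : ι × ι)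
    (η : (pmapTensor Q Q).domain) :
    inner ℂ (e.tensor p) (pmapTensor Q Q η) =
      ((n p.1 * n p.2 : ℝ) : ℂ) * inner ℂ (e.tensor p) (η : HilbertTensor H) := by
  obtain ⟨z, rfl⟩ := (LinearEquiv.ofInjective _ (inclTensor_injective Q.domain Q.domain)).surjective η
  rw [pmapTensor_inclTensor, LinearEquiv.ofInjective_apply]
  induction z with
  | zero => simp only [map_zero, UniformSpace.Completion.coe_zero, inner_zero_right, mul_zero]
  | tmul x y =>
    change inner ℂ (e.tensor p) (vecTensor (Q x) (Q y)) =
      _ * inner ℂ (e.tensor p) (vecTensor (x : H) (y : H))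
    rw [e.tensor_apply, inner_vecTensor, inner_vecTensor, hQ, hQ]
    push_cast
    ring
  | add x y hx hy =>
    rw [map_add, map_add, UniformSpace.Completion.coe_add, inner_add_right, inner_add_right, hx,
      hy, mul_add]

variable [CompleteSpace H]

instance (U : ℝ → H →L[ℂ] H) (n : ℤ) : CompleteSpace (weightSpace U n) :=
  (isClosed_weightSpace U n).completeSpace_coe

theorem inner_eq_zero_of_weightSpace {U : ℝ → H →L[ℂ] H} (hU : IsUnitaryRep U) {m n : ℤ}
    (hmn : m ≠ n) {ψ φ : H} (hψ : ψ ∈ weightSpace U m) (hφ : φ ∈ weightSpace U n) :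
    inner ℂ ψ φ = 0 := by
  have hnm : (n : ℝ) - m ≠ 0 := sub_ne_zero.2 (by exact_mod_cast hmn.symm)
  -- at this time the phases of the two vectors differ by `e^{iπ} = -1`
  have h := inner_apply_of_mem_unitary (hU.mem_unitary (Real.pi / (n - m))) ψ φ
  rw [hψ, hφ, inner_smul_left, inner_smul_right, ← mul_assoc, ← exp_conj, ← exp_add] at h
  have h2 : (starRingEnd ℂ) (I * ((Real.pi / (n - m) : ℝ) : ℂ) * ((m : ℝ) : ℂ)) +
      I * ((Real.pi / (n - m) : ℝ) : ℂ) * ((n : ℝ) : ℂ) = Real.pi * I := by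
    have hc : ((n : ℂ) - m) ≠ 0 := by exact_mod_cast hnm
    rw [map_mul, map_mul, conj_I, conj_ofReal, conj_ofReal]
    push_cast
    field_simp
    ring
  rw [h2, exp_pi_mul_I] at h
  have : (2 : ℂ) * inner ℂ ψ φ = 0 := by linear_combination -h
  simpa using this

local instance : Fact (0 < 2 * Real.pi) := ⟨Real.two_pi_pos⟩

open MeasureTheory AddCircle in
/-- A vector orthogonal to all weight spaces of a `2π`-periodic unitary group vanishes: the Fourier
coefficients of the continuous periodic function `t ↦ ⟪v, U t v⟫` are matrix elements of the
projections to the weight spaces. -/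
theorem eq_zero_of_orthogonal_weightSpace {U : ℝ → H →L[ℂ] H} (hU : IsUnitaryRep U)
    (hper : U (2 * Real.pi) = 1) {v : H} (hv : ∀ n, ∀ ψ ∈ weightSpace U n, inner ℂ v ψ = 0) :
    v = 0 := by
  have hp : Function.Periodic (fun t => U t v) (2 * Real.pi) := fun t => by
    simp only [hU.add_apply, hper, one_apply_eq_self]
  let f : AddCircle (2 * Real.pi) → H := hp.lift
  have hf : ∀ t : ℝ, f t = U t v := fun t => hp.lift_coe t
  have hfc : Continuous f :=
    (QuotientAddGroup.isQuotientMap_mk _).continuous_iff.2 (hU.strongly_continuous v)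
  have hfourier : ∀ (n : ℤ) (t : ℝ), fourier n (t : AddCircle (2 * Real.pi)) =
      exp (I * t * (n : ℝ)) := by
    intro n t
    rw [fourier_coe_apply]
    congr 1
    have : (Real.pi : ℂ) ≠ 0 := by exact_mod_cast Real.pi_ne_zero
    push_cast
    field_simp
  have hint : ∀ n : ℤ, Integrable (fun s => fourier (-n) s • f s)
      (haarAddCircle (T := 2 * Real.pi)) := fun n =>
    ((map_continuous (fourier (-n))).smul hfc).integrable_of_hasCompactSupport
      (HasCompactSupport.of_compactSpace _)
  have hmem : ∀ n, fourierCoeff f n ∈ weightSpace U n := by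
    intro n t
    have hshift : ∀ s : AddCircle (2 * Real.pi), U t (f s) = f (s + t) := by
      intro s
      induction s using QuotientAddGroup.induction_on with
      | H s =>
        change U t (f (s : AddCircle (2 * Real.pi))) = f ((s + t : ℝ) : AddCircle (2 * Real.pi))
        rw [hf, hf, ← hU.add_apply, add_comm]
    rw [fourierCoeff, ← ContinuousLinearMap.integral_comp_comm _ (hint n), ← integral_smul,
      ← integral_add_right_eq_self (μ := haarAddCircle)
        (fun s => exp (I * t * (n : ℝ)) • fourier (-n) s • f s) (t : AddCircle (2 * Real.pi))]
    congr 1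
    funext s
    have hadd : fourier (-n) (s + (t : AddCircle (2 * Real.pi))) =
        fourier (-n) s * fourier (-n) (t : AddCircle (2 * Real.pi)) := by
      simp only [fourier_apply, smul_add, toCircle_add, Circle.coe_mul]
    rw [map_smul, hshift, hadd, hfourier (-n), smul_smul]
    congr 1
    rw [mul_left_comm, ← exp_add]
    simp
  let F : C(AddCircle (2 * Real.pi), ℂ) := ⟨fun s => inner ℂ v (f s), by fun_prop⟩
  have hF : fourierCoeff F = 0 := by
    funext n
    rw [Pi.zero_apply, ← hv n _ (hmem n), fourierCoeff, fourierCoeff,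
      ← innerSL_apply_apply (𝕜 := ℂ) v, ← ContinuousLinearMap.integral_comp_comm _ (hint n)]
    simp [F]
  have h0 := has_pointwise_sum_fourier_series_of_summable (f := F) (hF ▸ summable_zero) 0
  simp only [hF, Pi.zero_apply, zero_smul] at h0
  have h1 : inner ℂ v (f ((0 : ℝ) : AddCircle (2 * Real.pi))) = 0 := h0.unique hasSum_zero
  rw [hf, hU.map_zero, one_apply_eq_self] at h1
  exact inner_self_eq_zero.1 h1

/-- A `2π`-periodic one-parameter unitary group has an orthonormal basis of eigenvectors, and the
spectrum of its generator is contained in `ℤ`. -/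
theorem exists_weight_basis {U : ℝ → H →L[ℂ] H} (hU : IsUnitaryRep U)
    (hper : U (2 * Real.pi) = 1) :
    ∃ (w : ∀ n : ℤ, Set (weightSpace U n)) (e : HilbertBasis (Σ n, w n) ℂ H),
      ∀ t i, U t (e i) = exp (I * t * ((i.1 : ℤ) : ℝ)) • e i := by
  choose w b hb using fun n => exists_hilbertBasis ℂ (weightSpace U n)
  have horth : OrthogonalFamily ℂ (fun n => weightSpace U n) fun n => (weightSpace U n).subtypeₗᵢ :=
    fun m n hmn ψ φ => inner_eq_zero_of_weightSpace hU hmn ψ.2 φ.2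
  have hon := horth.orthonormal_sigma_orthonormal (v_family := fun n => ⇑(b n))
    fun n => (b n).orthonormal
  refine ⟨w, HilbertBasis.mkOfOrthogonalEqBot hon ?_, fun t i => ?_⟩
  · rw [Submodule.eq_bot_iff]
    intro v hv
    refine eq_zero_of_orthogonal_weightSpace hU hper fun n ψ hψ => ?_
    have h : (innerSL ℂ v) ∘L (weightSpace U n).subtypeL = 0 := (b n).clm_ext fun i =>
      (Submodule.mem_orthogonal' _ _).1 hv _ (Submodule.subset_span ⟨⟨n, i⟩, rfl⟩)
    exact DFunLike.congr_fun h ⟨ψ, hψ⟩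
  · rw [HilbertBasis.coe_mkOfOrthogonalEqBot]
    exact (b i.1 i.2).2 t

section PmapTensor

variable {ι : Type*} {U : ℝ → H →L[ℂ] H} (e : HilbertBasis ι ℂ H) {n : ι → ℝ}

theorem inner_oneParamGenerator (hU : IsUnitaryRep U)
    (he : ∀ t i, U t (e i) = exp (I * t * n i) • e i) (i : ι) (ψ : (oneParamGenerator U).domain) :
    inner ℂ (e i) (oneParamGenerator U ψ) = n i * inner ℂ (e i) (ψ : H) := by
  have h1 := ((innerSL ℂ (e i)).restrictScalars ℝ).hasFDerivAt.comp_hasDerivAt (0 : ℝ)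
    (oneParamGenerator_hasDerivAt U ψ)
  have h2 : HasDerivAt (fun t : ℝ => exp (I * t * n i) * inner ℂ (e i) (ψ : H))
      (exp (I * (0 : ℝ) * n i) * (I * n i) * inner ℂ (e i) (ψ : H)) 0 := by
    have : HasDerivAt (fun t : ℝ => I * t * n i) (I * n i) 0 := by
      simpa using ((hasDerivAt_id (0 : ℝ)).ofReal_comp.const_mul I).mul_const (n i : ℂ)
    exact (this.cexp).mul_const _
  have h3 : (fun t : ℝ => exp (I * t * n i) * inner ℂ (e i) (ψ : H)) =
      ((innerSL ℂ (e i)).restrictScalars ℝ) ∘ fun t => U t (ψ : H) := by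
    funext t
    have := hU.inner_apply_left (-t) (e i) (ψ : H)
    rw [neg_neg] at this
    simp only [Function.comp_apply, ContinuousLinearMap.coe_restrictScalars', innerSL_apply_apply]
    rw [← this, he, inner_smul_left, ← exp_conj]
    simp
  rw [h3] at h2
  have h4 := h1.unique h2
  simp only [ContinuousLinearMap.coe_restrictScalars', map_smul, innerSL_apply_apply, ofReal_zero,
    mul_zero, zero_mul, exp_zero, one_mul, smul_eq_mul] at h4
  refine mul_left_cancel₀ I_ne_zero ?_
  rw [h4, mul_assoc]

/-- If the one-parameter group generated by `Q` has the eigenbasis `e` with eigenvalues `n i`, then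
`e^{itQ ⊗ Q}` is a one-parameter unitary group with eigenbasis `e ⊗ e` and eigenvalues
`n i * n j`. -/
theorem expI_pmapTensor (hU : IsUnitaryRep U)
    (he : ∀ t i, U t (e i) = exp (I * t * n i) • e i) :
    IsUnitaryRep (expI (pmapTensor (oneParamGenerator U) (oneParamGenerator U))) ∧
    ∀ (t : ℝ) i j, expI (pmapTensor (oneParamGenerator U) (oneParamGenerator U)) t
      (vecTensor (e i) (e j)) = exp (I * t * (n i * n j : ℝ)) • vecTensor (e i) (e j) := by
  obtain ⟨W, hW, hWe⟩ := e.tensor.exists_isUnitaryRep_diagonal fun p => n p.1 * n p.2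
  have hQ := inner_oneParamGenerator e hU he
  have hle : pmapTensor (oneParamGenerator U) (oneParamGenerator U) ≤ oneParamGenerator W := by
    have key := fun η => oneParamGenerator_of_hasDerivAt
      (hW.hasDerivAt_of_coefficients e.tensor _ hWe fun p => inner_pmapTensor e hQ p η)
    refine ⟨fun η hη => (key ⟨η, hη⟩).1, fun η η' hηη' => ?_⟩
    obtain ⟨h1, h2⟩ := key η
    rw [← h2]
    congr 1
    exact Subtype.ext hηη'
  obtain ⟨h1, h2⟩ := isUnitaryRep_expI ⟨W, hW, hle⟩
  refine ⟨h1, fun t i j => h1.apply_of_hasDerivAt ?_ t⟩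
  have hei : ∀ i, ∃ h : e i ∈ (oneParamGenerator U).domain,
      oneParamGenerator U ⟨e i, h⟩ = (n i : ℂ) • e i := by
    intro i
    refine oneParamGenerator_of_hasDerivAt (hU.hasDerivAt_of_coefficients e n he fun j => ?_)
    classical
    rw [inner_smul_right, orthonormal_iff_ite.1 e.orthonormal]
    split_ifs with h
    · rw [h]
    · simp
  obtain ⟨hi, hi'⟩ := hei i
  obtain ⟨hj, hj'⟩ := hei j
  have hmem : vecTensor (e i) (e j) ∈
      (pmapTensor (oneParamGenerator U) (oneParamGenerator U)).domain :=
    ⟨(⟨e i, hi⟩ : (oneParamGenerator U).domain) ⊗ₜ ⟨e j, hj⟩, rfl⟩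
  have hval := pmapTensor_apply (oneParamGenerator U) (oneParamGenerator U)
    ⟨e i, hi⟩ ⟨e j, hj⟩ hmem
  rw [hi', hj', vecTensor_smul_left, vecTensor_smul_right, smul_smul,
    h2.2 (y := ⟨_, h2.1 hmem⟩) rfl] at hval
  have hd := oneParamGenerator_hasDerivAt
    (expI (pmapTensor (oneParamGenerator U) (oneParamGenerator U))) ⟨_, h2.1 hmem⟩
  rw [hval] at hd
  simpa using hd

end PmapTensor

end Weights

/-! ### Smearing with test functions on momentum space -/

section Smearing

open Complex MeasureTheory FourierTransform Filter

theorem continuous_minkowski : Continuous fun p : Spacetime × Spacetime => minkowski p.1 p.2 := by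
  unfold minkowski
  fun_prop

/-- The Fourier transform of a test function with respect to the Minkowski product. -/
def minkowskiFourier (h : Spacetime → ℂ) (a : Spacetime) : ℂ :=
  ∫ q : Spacetime, exp (-I * (minkowski q a : ℂ)) * h q

/-- The reflection `(a₀, a₁) ↦ (a₀, -a₁)`, which turns the Minkowski product into the Euclidean
one. -/
def spaceReflection : Spacetime ≃ₗᵢ[ℝ] Spacetime :=
  LinearIsometryEquiv.piLpCongrRight 2 ![LinearIsometryEquiv.refl ℝ ℝ, LinearIsometryEquiv.neg ℝ]

theorem inner_spaceReflection (q a : Spacetime) :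
    inner ℝ q (spaceReflection a) = minkowski q a := by
  simp [spaceReflection, minkowski, PiLp.inner_apply, Fin.sum_univ_two]
  ring

theorem minkowskiFourier_eq (h : Spacetime → ℂ) (a : Spacetime) :
    minkowskiFourier h a = 𝓕 h ((2 * Real.pi)⁻¹ • spaceReflection a) := by
  rw [Real.fourier_eq', minkowskiFourier]
  congr 1
  funext q
  rw [inner_smul_right, inner_spaceReflection, smul_eq_mul]
  congr 2
  have : (Real.pi : ℂ) ≠ 0 := by exact_mod_cast Real.pi_ne_zero
  push_cast
  field_simp

theorem integrable_minkowskiFourier {h : Spacetime → ℂ} (hs : ContDiff ℝ ∞ h)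
    (hc : HasCompactSupport h) : Integrable (minkowskiFourier h) := by
  have h1 : Integrable (𝓕 h) := (𝓕 (hc.toSchwartzMap hs)).integrable
  have h2 := (h1.comp_smul (R := (2 * Real.pi)⁻¹) (by positivity))
  have h3 := (spaceReflection.measurePreserving.integrable_comp_emb
    spaceReflection.toHomeomorph.measurableEmbedding).2 h2
  refine h3.congr (Eventually.of_forall fun a => ?_)
  simp [minkowskiFourier_eq]

theorem continuous_minkowskiFourier {h : Spacetime → ℂ} (hs : ContDiff ℝ ∞ h)
    (hc : HasCompactSupport h) : Continuous (minkowskiFourier h) := by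
  have h1 : Continuous (𝓕 h) := (𝓕 (hc.toSchwartzMap hs)).continuous
  rw [funext (minkowskiFourier_eq h)]
  fun_prop

theorem integral_minkowskiFourier_ne_zero {h : Spacetime → ℂ} (hs : ContDiff ℝ ∞ h)
    (hc : HasCompactSupport h) (h0 : h 0 = 1) : ∫ a, minkowskiFourier h a ≠ 0 := by
  have h1 : ∫ w, 𝓕 h w = 1 := by
    have h2 := DFunLike.congr_fun
      (FourierTransform.fourierInv_fourier_eq (F := SchwartzMap Spacetime ℂ)
        (hc.toSchwartzMap hs)) (0 : Spacetime)
    rw [SchwartzMap.fourierInv_coe, SchwartzMap.fourier_coe, Real.fourierInv_eq'] at h2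
    have hco : ⇑(hc.toSchwartzMap hs) = h := rfl
    simpa [hco, h0] using h2
  simp_rw [minkowskiFourier_eq]
  have h3 := spaceReflection.measurePreserving.integral_comp
    spaceReflection.toHomeomorph.measurableEmbedding
    fun a : Spacetime => 𝓕 h ((2 * Real.pi)⁻¹ • a)
  have h4 := Measure.integral_comp_smul (volume : Measure Spacetime) (𝓕 h) (2 * Real.pi)⁻¹
  erw [h3]
  rw [h4, h1, smul_ne_zero_iff]
  refine ⟨?_, one_ne_zero⟩
  positivity

theorem minkowskiFourier_sum {κ : Type*} (s : Finset κ) (h : κ → Spacetime → ℂ)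
    (hs : ∀ i, ContDiff ℝ ∞ (h i)) (hc : ∀ i, HasCompactSupport (h i)) (a : Spacetime) :
    minkowskiFourier (fun q => ∑ i ∈ s, h i q) a = ∑ i ∈ s, minkowskiFourier (h i) a := by
  simp only [minkowskiFourier, Finset.mul_sum]
  refine integral_finsetSum _ fun i _ => ?_
  have hm : Continuous fun q : Spacetime => minkowski q a :=
    continuous_minkowski.comp (by fun_prop : Continuous fun q : Spacetime => (q, a))
  have := (hs i).continuous
  exact Continuous.integrable_of_hasCompactSupport (by fun_prop) (hc i).mul_left

/-- Rescaling the argument of a test function. -/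
theorem minkowskiFourier_comp_smul (h : Spacetime → ℂ) {r : ℝ} (hr : 0 < r) (a : Spacetime) :
    minkowskiFourier (fun q => h (r • q)) (r • a) = ((r ^ 2)⁻¹ : ℝ) • minkowskiFourier h a := by
  have := Measure.integral_comp_smul (volume : Measure Spacetime)
    (fun q => exp (-I * (minkowski q a : ℂ)) * h q) r
  rw [minkowskiFourier, minkowskiFourier, show (r ^ 2)⁻¹ =
    |(r ^ Module.finrank ℝ Spacetime)⁻¹| by
      rw [finrank_euclideanSpace_fin, abs_of_nonneg (by positivity)], ← this]
  congr 1
  funext q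
  congr 4
  simp [minkowski]
  ring

variable {E : Type*} [NormedAddCommGroup E] [InnerProductSpace ℂ E] [CompleteSpace E]

/-- The operator `∫ h dE` (up to the factor `(2π)²`) for a test function `h` on momentum space. -/
def smear (T : Spacetime → E →L[ℂ] E) (h : Spacetime → ℂ) (ψ : E) : E :=
  ∫ a : Spacetime, minkowskiFourier h a • T a ψ

variable {T : Spacetime → E →L[ℂ] E} (hT : IsUnitaryRep T)

include hT

theorem integrable_smul_apply {f : Spacetime → ℂ} (hf : Integrable f) (ψ : E) :
    Integrable fun a => f a • T a ψ := by
  refine hf.norm.mul_const ‖ψ‖ |>.mono'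
    (hf.aestronglyMeasurable.smul (hT.strongly_continuous ψ).aestronglyMeasurable)
    (Eventually.of_forall fun a => ?_)
  rw [norm_smul, hT.norm_apply]

theorem exists_clm_smear {h : Spacetime → ℂ} (hs : ContDiff ℝ ∞ h) (hc : HasCompactSupport h) :
    ∃ A : E →L[ℂ] E, ∀ ψ, A ψ = smear T h ψ := by
  have hi := fun ψ => integrable_smul_apply hT (integrable_minkowskiFourier hs hc) ψ
  refine ⟨LinearMap.mkContinuous
    { toFun := smear T h
      map_add' := fun ψ φ => by
        simp only [smear, map_add, smul_add]
        exact integral_add (hi ψ) (hi φ)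
      map_smul' := fun c ψ => by
        simp only [smear, map_smul, RingHom.id_apply, ← integral_smul]
        congr 1
        funext a
        rw [smul_comm] } (∫ a, ‖minkowskiFourier h a‖) fun ψ => ?_, fun ψ => rfl⟩
  refine (norm_integral_le_integral_norm _).trans (le_of_eq ?_)
  rw [← integral_mul_const]
  simp only [norm_smul, hT.norm_apply]

theorem smear_sum {κ : Type*} (s : Finset κ) (h : κ → Spacetime → ℂ)
    (hs : ∀ i, ContDiff ℝ ∞ (h i)) (hc : ∀ i, HasCompactSupport (h i)) (ψ : E) :
    smear T (fun q => ∑ i ∈ s, h i q) ψ = ∑ i ∈ s, smear T (h i) ψ := by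
  simp only [smear, minkowskiFourier_sum s h hs hc, Finset.sum_smul]
  exact integral_finsetSum _ fun i _ =>
    integrable_smul_apply hT (integrable_minkowskiFourier (hs i) (hc i)) ψ

/-- The spectral measure vanishes off the joint spectrum: the local vanishing in the definition of
the joint spectrum globalizes by a partition of unity. -/
theorem smear_eq_zero_of_tsupport_subset {h : Spacetime → ℂ} (hs : ContDiff ℝ ∞ h)
    (hc : HasCompactSupport h) (hsupp : tsupport h ⊆ (jointSpectrum T)ᶜ) (ψ : E) :
    smear T h ψ = 0 := by
  have hloc : ∀ p ∈ tsupport h, ∃ N ∈ 𝓝 p, IsOpen N ∧ ∀ k : Spacetime → ℂ, ContDiff ℝ ∞ k →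
      HasCompactSupport k → tsupport k ⊆ N → ∀ φ, smear T k φ = 0 := by
    intro p hp
    have := hsupp hp
    simp only [jointSpectrum, Set.mem_compl_iff, Set.mem_ofPred_eq] at this
    push Not at this
    obtain ⟨N, hN, hN'⟩ := this
    obtain ⟨N', hN'N, hN'o, hpN'⟩ := mem_nhds_iff.1 hN
    exact ⟨N', hN'o.mem_nhds hpN', hN'o, fun k h1 h2 h3 φ => hN' k h1 h2 (h3.trans hN'N) φ⟩
  choose! N hN hNo hNk using hloc
  obtain ⟨t, ht, htU⟩ := IsCompact.elim_nhds_subcover hc N hN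
  obtain ⟨f, hf⟩ := SmoothPartitionOfUnity.exists_isSubordinate (modelWithCornersSelf ℝ Spacetime)
    (isClosed_tsupport h) (fun i : t => N i) (fun i => hNo i (ht i i.2)) (by
      intro x hx
      have := htU hx
      simp only [Set.mem_iUnion] at this ⊢
      obtain ⟨i, hi, hxi⟩ := this
      exact ⟨⟨i, hi⟩, hxi⟩)
  have hfs : ∀ i, ContDiff ℝ ∞ fun q => ((f i q : ℝ) : ℂ) * h q := fun i =>
    (ofRealCLM.contDiff.comp (f i).contMDiff.contDiff).mul hs
  have hfc : ∀ i, HasCompactSupport fun q => ((f i q : ℝ) : ℂ) * h q := fun i => hc.mul_left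
  have hsum : h = fun q => ∑ i : t, ((f i q : ℝ) : ℂ) * h q := by
    funext q
    rw [← Finset.sum_mul]
    by_cases hq : q ∈ tsupport h
    · have := f.sum_eq_one hq
      rw [finsum_eq_sum_of_fintype] at this
      rw [← ofReal_sum, this, ofReal_one, one_mul]
    · rw [image_eq_zero_of_notMem_tsupport hq, mul_zero]
  rw [hsum, smear_sum hT _ _ hfs hfc]
  refine Finset.sum_eq_zero fun i _ => hNk i (ht i i.2) _ (hfs i) (hfc i) ?_ ψ
  refine (closure_mono fun q hq => ?_).trans (hf i)
  rw [Function.mem_support] at hq ⊢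
  intro h0
  simp [h0] at hq

/-- Smearing with `g (r q)`, `r → 0`, is an approximate identity. -/
theorem tendsto_smear_comp_smul {g : Spacetime → ℂ} (hs : ContDiff ℝ ∞ g)
    (hc : HasCompactSupport g) (ψ : E) :
    Tendsto (fun r : ℝ => smear T (fun q => g (r • q)) ψ) (𝓝[>] 0)
      (𝓝 ((∫ a, minkowskiFourier g a) • ψ)) := by
  have hi := integrable_minkowskiFourier hs hc
  have h1 : ∀ r : ℝ, 0 < r → smear T (fun q => g (r • q)) ψ =
      ∫ a, minkowskiFourier g a • T (r • a) ψ := by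
    intro r hr
    have := Measure.integral_comp_smul (volume : Measure Spacetime)
      (fun a => minkowskiFourier (fun q => g (r • q)) a • T a ψ) r
    rw [finrank_euclideanSpace_fin, abs_of_nonneg (by positivity)] at this
    have h2 : ∀ a, minkowskiFourier (fun q => g (r • q)) (r • a) • T (r • a) ψ =
        ((r ^ 2)⁻¹ : ℝ) • (minkowskiFourier g a • T (r • a) ψ) := by
      intro a
      rw [minkowskiFourier_comp_smul g hr, smul_assoc]
    simp only [h2, integral_smul] at this
    exact (smul_right_injective E (by positivity : (r ^ 2)⁻¹ ≠ 0) this).symm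
  have h4 : ∀ᶠ r in 𝓝[>] (0 : ℝ), ∫ a, minkowskiFourier g a • T (r • a) ψ =
      smear T (fun q => g (r • q)) ψ := by
    filter_upwards [self_mem_nhdsWithin] with r hr using (h1 r hr).symm
  refine Tendsto.congr' h4 ?_
  rw [← integral_smul_const]
  refine tendsto_integral_filter_of_dominated_convergence (fun a => ‖minkowskiFourier g a‖ * ‖ψ‖)
    (Eventually.of_forall fun r => hi.aestronglyMeasurable.smul
      ((hT.strongly_continuous ψ).comp (continuous_const_smul r)).aestronglyMeasurable)
    (Eventually.of_forall fun r => Eventually.of_forall fun a => ?_)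
    (hi.norm.mul_const _) (Eventually.of_forall fun a => ?_)
  · rw [norm_smul, hT.norm_apply]
  · refine Tendsto.const_smul ?_ _
    have h3 : Continuous fun r : ℝ => T (r • a) ψ :=
      (hT.strongly_continuous ψ).comp (by fun_prop)
    have := h3.tendsto 0
    rw [zero_smul, hT.map_zero, one_apply_eq_self] at this
    exact this.mono_left nhdsWithin_le_nhds

end Smearing

/-! ### The spectrum condition for tensor products -/

section HalfPlane

open Complex MeasureTheory FourierTransform Filter
open scoped Convolution

/-- The test function `q ↦ ∫ h (p + q) g(p) e^{-i p · b} dp`, whose Fourier transform at `a` is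
`ĥ(a) ĝ(b - a)`. -/
def correlation (g h : Spacetime → ℂ) (b : Spacetime) : Spacetime → ℂ :=
  (fun t => exp (I * (minkowski t b : ℂ)) * g (-t)) ⋆[ContinuousLinearMap.mul ℂ ℂ] h

theorem contDiff_phase (b : Spacetime) :
    ContDiff ℝ ∞ fun t : Spacetime => exp (I * (minkowski t b : ℂ)) := by
  have : ContDiff ℝ ∞ fun t : Spacetime => minkowski t b := by
    unfold minkowski
    fun_prop
  exact ContDiff.cexp (contDiff_const.mul (ofRealCLM.contDiff.comp this))

theorem contDiff_reflected {g : Spacetime → ℂ} (hgs : ContDiff ℝ ∞ g) (b : Spacetime) :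
    ContDiff ℝ ∞ fun t : Spacetime => exp (I * (minkowski t b : ℂ)) * g (-t) :=
  (contDiff_phase b).mul (hgs.comp contDiff_neg)

theorem hasCompactSupport_reflected {g : Spacetime → ℂ} (hgc : HasCompactSupport g)
    (b : Spacetime) :
    HasCompactSupport fun t : Spacetime => exp (I * (minkowski t b : ℂ)) * g (-t) :=
  (hgc.comp_homeomorph (Homeomorph.neg Spacetime)).mul_left

theorem contDiff_correlation {g h : Spacetime → ℂ} (hgs : ContDiff ℝ ∞ g)
    (hhs : ContDiff ℝ ∞ h) (hhc : HasCompactSupport h) (b : Spacetime) :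
    ContDiff ℝ ∞ (correlation g h b) := by
  have := (contDiff_reflected hgs b).continuous.locallyIntegrable (μ := volume)
  exact hhc.contDiff_convolution_right (ContinuousLinearMap.mul ℝ ℂ) this hhs

theorem hasCompactSupport_correlation {g h : Spacetime → ℂ} (hgc : HasCompactSupport g)
    (hhc : HasCompactSupport h) (b : Spacetime) : HasCompactSupport (correlation g h b) :=
  (hasCompactSupport_reflected hgc b).convolution _ hhc

theorem minkowskiFourier_correlation {g h : Spacetime → ℂ} (hgs : ContDiff ℝ ∞ g)
    (hgc : HasCompactSupport g) (hhs : ContDiff ℝ ∞ h) (hhc : HasCompactSupport h)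
    (a b : Spacetime) :
    minkowskiFourier (correlation g h b) a = minkowskiFourier h a * minkowskiFourier g (b - a) := by
  have h1 : minkowskiFourier (fun t => exp (I * (minkowski t b : ℂ)) * g (-t)) a =
      minkowskiFourier g (b - a) := by
    rw [minkowskiFourier, minkowskiFourier, ← integral_neg_eq_self]
    congr 1
    funext t
    rw [neg_neg, ← mul_assoc, ← exp_add]
    congr 2
    simp only [minkowski, PiLp.neg_apply, PiLp.sub_apply]
    push_cast
    ring
  rw [← h1, mul_comm, minkowskiFourier_eq, minkowskiFourier_eq, minkowskiFourier_eq, correlation,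
    Real.fourier_mul_convolution_eq
      ((contDiff_reflected hgs b).continuous.integrable_of_hasCompactSupport
        (hasCompactSupport_reflected hgc b))
      (hhs.continuous.integrable_of_hasCompactSupport hhc)]

theorem tsupport_correlation_subset {g h : Spacetime → ℂ} (l : Spacetime →L[ℝ] ℝ) {c d : ℝ}
    (hg : ∀ p, g p ≠ 0 → c ≤ l p) (hh : ∀ p, h p ≠ 0 → l p ≤ d) (b : Spacetime) :
    tsupport (correlation g h b) ⊆ {q | l q ≤ d - c} := by
  refine closure_minimal ((support_convolution_subset _).trans ?_)
    (isClosed_le l.continuous continuous_const)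
  rintro _ ⟨t, ht, q, hq, rfl⟩
  have h1 := hg (-t) (right_ne_zero_of_mul ht)
  have h2 := hh q hq
  rw [map_neg] at h1
  simp only [Set.mem_ofPred_eq, map_add]
  linarith

variable {E : Type*} [NormedAddCommGroup E] [InnerProductSpace ℂ E] [CompleteSpace E]
  {T : Spacetime → E →L[ℂ] E} (hT : IsUnitaryRep T)

include hT

/-- The convolution theorem for `T ⊗ T`: smearing `T ⊗ T` with `h` on a vector whose first factor
is smeared with `g` amounts to smearing the second factor with the correlations of `g` and `h`. -/
theorem smear_opTensor_smear {g h : Spacetime → ℂ} (hgs : ContDiff ℝ ∞ g)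
    (hgc : HasCompactSupport g) (hhs : ContDiff ℝ ∞ h) (hhc : HasCompactSupport h) (ψ φ : E) :
    smear (fun a => opTensor (T a) (T a)) h (vecTensor (smear T g ψ) φ) =
      ∫ b, vecTensor (T b ψ) (smear T (correlation g h b) φ) := by
  have hg := integrable_minkowskiFourier hgs hgc
  have hh := integrable_minkowskiFourier hhs hhc
  have hgcont := continuous_minkowskiFourier hgs hgc
  have hhcont := continuous_minkowskiFourier hhs hhc
  have hTψ := hT.strongly_continuous ψ
  have hTφ := hT.strongly_continuous φ
  let F : Spacetime → Spacetime → HilbertTensor E := fun b a =>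
    (minkowskiFourier h a * minkowskiFourier g (b - a)) • vecTensor (T b ψ) (T a φ)
  have hF : Integrable (Function.uncurry F) (volume.prod volume) := by
    have h1 := (hh.convolution_integrand (ContinuousLinearMap.mul ℂ ℂ) hg).norm.mul_const
      (‖ψ‖ * ‖φ‖)
    refine h1.mono' (Continuous.aestronglyMeasurable ?_) (Eventually.of_forall fun p => ?_)
    · have : Continuous fun p : Spacetime × Spacetime => vecTensorL E (T p.1 ψ) (T p.2 φ) :=
        ((vecTensorL E).continuous.comp (hTψ.comp continuous_fst)).clm_apply
          (hTφ.comp continuous_snd)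
      have hc : Continuous fun p : Spacetime × Spacetime =>
          minkowskiFourier h p.2 * minkowskiFourier g (p.1 - p.2) := by fun_prop
      exact hc.smul this
    · simp only [Function.uncurry, F, norm_smul, ContinuousLinearMap.mul_apply']
      rw [vecTensor, UniformSpace.Completion.norm_coe, TensorProduct.norm_tmul, hT.norm_apply,
        hT.norm_apply]
  have hinner : ∀ a, minkowskiFourier h a • opTensor (T a) (T a) (vecTensor (smear T g ψ) φ) =
      ∫ b, F b a := by
    intro a
    have h2 : T a (smear T g ψ) = ∫ b, minkowskiFourier g (b - a) • T b ψ := by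
      rw [smear, ← ContinuousLinearMap.integral_comp_comm _ (integrable_smul_apply hT hg ψ),
        ← integral_sub_right_eq_self (μ := volume) _ a]
      congr 1
      funext b
      rw [map_smul, ← hT.add_apply, add_sub_cancel]
    rw [opTensor_vecTensor, h2]
    change minkowskiFourier h a • (vecTensorL E).flip (T a φ) _ = _
    rw [← ContinuousLinearMap.integral_comp_comm _
      (integrable_smul_apply hT (hg.comp_sub_right a) ψ), ← integral_smul]
    congr 1
    funext b
    rw [map_smul, smul_smul]
    rfl
  have houter : ∀ b, vecTensor (T b ψ) (smear T (correlation g h b) φ) = ∫ a, F b a := by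
    intro b
    rw [smear, ← vecTensorL_apply, ← ContinuousLinearMap.integral_comp_comm _
      (integrable_smul_apply hT (integrable_minkowskiFourier
        (contDiff_correlation hgs hhs hhc b) (hasCompactSupport_correlation hgc hhc b))
        φ)]
    congr 1
    funext a
    rw [map_smul, minkowskiFourier_correlation hgs hgc hhs hhc]
    rfl
  rw [smear, funext hinner, funext houter, integral_integral_swap hF]

/-- If `T` has spectrum in the half-plane `l ≥ 0`, then every multiple of `ψ` by a suitable nonzero
constant is a limit of vectors smeared with test functions supported in `l ≥ -ε`. -/
theorem exists_tendsto_smear (l : Spacetime →L[ℝ] ℝ)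
    (hl : ∀ h : Spacetime → ℂ, ContDiff ℝ ∞ h → HasCompactSupport h →
      tsupport h ⊆ {p | l p < 0} → ∀ ψ, smear T h ψ = 0) {ε : ℝ} (hε : 0 < ε) (ψ : E) :
    ∃ (c : ℂ) (g : ℝ → Spacetime → ℂ), c ≠ 0 ∧
      (∀ r, 0 < r → ContDiff ℝ ∞ (g r) ∧ HasCompactSupport (g r) ∧ ∀ p, g r p ≠ 0 → -ε ≤ l p) ∧
      Tendsto (fun r => smear T (g r) ψ) (𝓝[>] 0) (𝓝 (c • ψ)) := by
  let f : ContDiffBump (0 : Spacetime) := default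
  let k : Spacetime → ℂ := fun p => (f p : ℂ)
  have hks : ContDiff ℝ ∞ k := ofRealCLM.contDiff.comp f.contDiff
  have hkc : HasCompactSupport k := f.hasCompactSupport.comp_left ofReal_zero
  have hk0 : k 0 = 1 := by
    simp [k, f.one_of_mem_closedBall (Metric.mem_closedBall_self f.rIn_pos.le)]
  -- a smooth cutoff which is `1` for `l ≥ -ε / 2` and `0` for `l ≤ -ε`
  let θ : Spacetime → ℂ := fun p => (Real.smoothTransition (2 * (l p + ε) / ε) : ℂ)
  have hθs : ContDiff ℝ ∞ θ := by
    refine ofRealCLM.contDiff.comp (Real.smoothTransition.contDiff.comp ?_)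
    have := l.contDiff (n := ∞)
    fun_prop
  have hsmul : ∀ r : ℝ, 0 < r → ContDiff ℝ ∞ (fun p => k (r • p)) ∧
      HasCompactSupport fun p => k (r • p) := fun r hr =>
    ⟨hks.comp (contDiff_const_smul r), hkc.comp_smul hr.ne'⟩
  refine ⟨∫ a, minkowskiFourier k a, fun r p => θ p * k (r • p),
    integral_minkowskiFourier_ne_zero hks hkc hk0,
    fun r hr => ⟨hθs.mul (hsmul r hr).1, (hsmul r hr).2.mul_left, fun p hp => ?_⟩,
    Tendsto.congr' ?_ (tendsto_smear_comp_smul hT hks hkc ψ)⟩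
  · by_contra hlt
    refine left_ne_zero_of_mul hp ?_
    have : 2 * (l p + ε) / ε ≤ 0 := div_nonpos_of_nonpos_of_nonneg (by linarith) hε.le
    simp [θ, Real.smoothTransition.zero_of_nonpos this]
  · filter_upwards [self_mem_nhdsWithin] with r hr
    obtain ⟨h1, h2⟩ := hsmul r hr
    have hcs : ContDiff ℝ ∞ fun p => (1 - θ p) * k (r • p) := (contDiff_const.sub hθs).mul h1
    have hcc : HasCompactSupport fun p => (1 - θ p) * k (r • p) := h2.mul_left
    have hzero : smear T (fun p => (1 - θ p) * k (r • p)) ψ = 0 := by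
      refine hl _ hcs hcc ?_ ψ
      have hsub : tsupport (fun p => (1 - θ p) * k (r • p)) ⊆ {p | l p ≤ -ε / 2} := by
        refine closure_minimal (fun p hp => ?_) (isClosed_le l.continuous continuous_const)
        by_contra hlt
        simp only [Set.mem_ofPred_eq, not_le] at hlt
        refine left_ne_zero_of_mul hp ?_
        have : 1 ≤ 2 * (l p + ε) / ε := by
          rw [le_div_iff₀ hε]
          linarith
        simp [θ, Real.smoothTransition.one_of_one_le this]
      intro p hp
      have h3 : l p ≤ -ε / 2 := hsub hp
      change l p < 0
      linarith
    have hadd := smear_sum hT Finset.univ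
      ![fun p => θ p * k (r • p), fun p => (1 - θ p) * k (r • p)]
      (by intro i; fin_cases i <;> [exact hθs.mul h1; exact hcs])
      (by intro i; fin_cases i <;> [exact h2.mul_left; exact hcc]) ψ
    simp only [Fin.sum_univ_two, Matrix.cons_val_zero, Matrix.cons_val_one] at hadd
    rw [hzero, add_zero] at hadd
    rw [← hadd]
    congr 1
    funext p
    ring

/-- If `T` has spectrum in the half-plane `l ≥ 0`, then so has `T ⊗ T`. -/
theorem smear_opTensor_eq_zero (l : Spacetime →L[ℝ] ℝ)
    (hl : ∀ h : Spacetime → ℂ, ContDiff ℝ ∞ h → HasCompactSupport h →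
      tsupport h ⊆ {p | l p < 0} → ∀ ψ, smear T h ψ = 0) {d : ℝ} (hd : 0 < d) {h : Spacetime → ℂ}
    (hhs : ContDiff ℝ ∞ h) (hhc : HasCompactSupport h) (hsupp : ∀ p, h p ≠ 0 → l p ≤ -d)
    (Ψ : HilbertTensor E) : smear (fun a => opTensor (T a) (T a)) h Ψ = 0 := by
  obtain ⟨A, hA⟩ := exists_clm_smear hT.opTensor hhs hhc
  suffices A = 0 by rw [← hA, this, zero_apply]
  refine HilbertTensor.clm_ext fun ψ φ => ?_
  obtain ⟨c, g, hc, hg, hlim⟩ := exists_tendsto_smear hT l hl (half_pos hd) ψ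
  have hzero : ∀ r, 0 < r → A (vecTensor (smear T (g r) ψ) φ) = 0 := by
    intro r hr
    obtain ⟨h1, h2, h3⟩ := hg r hr
    rw [hA, smear_opTensor_smear hT h1 h2 hhs hhc]
    refine integral_eq_zero_of_ae (Eventually.of_forall fun b => ?_)
    have : smear T (correlation (g r) h b) φ = 0 := by
      refine hl _ (contDiff_correlation h1 hhs hhc b)
        (hasCompactSupport_correlation h2 hhc b) (fun q hq => ?_) φ
      have h4 : l q ≤ -d - -(d / 2) := tsupport_correlation_subset l h3 hsupp b hq
      change l q < 0
      linarith
    simp only [this, ← vecTensorL_apply, map_zero, Pi.zero_apply]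
  have h1 : Tendsto (fun r => A (vecTensor (smear T (g r) ψ) φ)) (𝓝[>] 0)
      (𝓝 (A (vecTensor (c • ψ) φ))) :=
    ((A ∘L (vecTensorL E).flip φ).continuous.tendsto _).comp hlim
  have h2 : Tendsto (fun r => A (vecTensor (smear T (g r) ψ) φ)) (𝓝[>] 0) (𝓝 0) := by
    refine Tendsto.congr' ?_ tendsto_const_nhds
    filter_upwards [self_mem_nhdsWithin] with r hr using (hzero r hr).symm
  have h3 := tendsto_nhds_unique h1 h2
  rw [vecTensor_smul_left, map_smul] at h3
  rw [(smul_eq_zero.1 h3).resolve_left hc, zero_apply]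

/-- The spectrum condition is inherited by `T ⊗ T`. -/
theorem jointSpectrum_opTensor_subset (hspec : jointSpectrum T ⊆ forwardCone) :
    jointSpectrum (fun a => opTensor (T a) (T a)) ⊆ forwardCone := by
  intro p hp
  by_contra hpc
  -- the forward cone is the intersection of the half-planes `p₀ ± p₁ ≥ 0`
  obtain ⟨l, hcone, hlp⟩ : ∃ l : Spacetime →L[ℝ] ℝ,
      (∀ q ∈ forwardCone, 0 ≤ l q) ∧ l p < 0 := by
    simp only [forwardCone, Set.mem_ofPred_eq, not_le] at hpc
    rcases lt_abs.1 hpc with h | h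
    · refine ⟨EuclideanSpace.proj 0 - EuclideanSpace.proj 1, fun q hq => ?_, ?_⟩
      · have := (le_abs_self (q 1)).trans hq
        simpa using this
      · simpa using h
    · refine ⟨EuclideanSpace.proj 0 + EuclideanSpace.proj 1, fun q hq => ?_, ?_⟩
      · have := (neg_abs_le (q 1)).trans' (neg_le_neg hq)
        change 0 ≤ q 0 + q 1
        linarith
      · change p 0 + p 1 < 0
        linarith
  have hN : {q | l q < l p / 2} ∈ 𝓝 p :=
    (isOpen_lt l.continuous continuous_const).mem_nhds (by
      simp only [Set.mem_ofPred_eq]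
      linarith)
  obtain ⟨h, hhs, hhc, hsupp, Ψ, hΨ⟩ := hp _ hN
  refine hΨ (smear_opTensor_eq_zero hT l (fun k hks hkc hk ψ =>
    smear_eq_zero_of_tsupport_subset hT hks hkc (fun q hq hq' => ?_) ψ)
    (d := -(l p / 2)) (by linarith) hhs hhc (fun q hq => ?_) Ψ)
  · have h1 : l q < 0 := hk hq
    linarith [hcone q (hspec hq')]
  · have h1 : l q < l p / 2 := hsupp (subset_tsupport h hq)
    linarith

end HalfPlane

/-! ### Von Neumann algebras and cyclic vectors -/

section VonNeumann

variable {H : Type*} [NormedAddCommGroup H] [InnerProductSpace ℂ H] [CompleteSpace H]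

theorem mem_generatedVonNeumannAlgebra_iff {S : Set (H →L[ℂ] H)} (hS : ∀ s ∈ S, star s ∈ S)
    {z : H →L[ℂ] H} :
    z ∈ generatedVonNeumannAlgebra S ↔ ∀ c, (∀ s ∈ S, s * c = c * s) → c * z = z * c := by
  have hc : ∀ c, c ∈ (StarSubalgebra.centralizer ℂ S : Set (H →L[ℂ] H)) ↔
      ∀ s ∈ S, s * c = c * s := fun c =>
    ⟨fun h s hs => ((StarSubalgebra.mem_centralizer_iff ℂ).1 h s hs).1,
      fun h => (StarSubalgebra.mem_centralizer_iff ℂ).2 fun s hs => ⟨h s hs, h _ (hS s hs)⟩⟩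
  change z ∈ StarSubalgebra.centralizer ℂ
    (StarSubalgebra.centralizer ℂ S : Set (H →L[ℂ] H)) ↔ _
  rw [StarSubalgebra.mem_centralizer_iff]
  refine ⟨fun h c h' => (h c ((hc c).2 h')).1, fun h c h' => ⟨h c ((hc c).1 h'), h _ ?_⟩⟩
  exact (hc _).1 (star_mem (S := StarSubalgebra ℂ (H →L[ℂ] H)) h')

/-- A vector which is separating for a von Neumann algebra is cyclic for its commutant. -/
theorem VonNeumannAlgebra.dense_commutant_of_separating {M : VonNeumannAlgebra H} {Ω : H}
    (hsep : ∀ x ∈ M, x Ω = 0 → x = 0) : Dense {ψ : H | ∃ x ∈ M.commutant, x Ω = ψ} := by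
  let K₀ : Submodule ℂ H :=
    { carrier := {ψ | ∃ x ∈ M.commutant, x Ω = ψ}
      add_mem' := by
        rintro _ _ ⟨x, hx, rfl⟩ ⟨y, hy, rfl⟩
        exact ⟨x + y, add_mem hx hy, rfl⟩
      zero_mem' := ⟨0, zero_mem _, rfl⟩
      smul_mem' := by
        rintro c _ ⟨x, hx, rfl⟩
        exact ⟨c • x, M.commutant.toStarSubalgebra.smul_mem hx c, rfl⟩ }
  change Dense (K₀ : Set H)
  let K := K₀.topologicalClosure
  have : CompleteSpace K := K₀.isClosed_topologicalClosure.completeSpace_coe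
  -- the projection onto the closure of `M' Ω` belongs to `M'' = M`
  have hp : K.starProjection ∈ M := by
    rw [VonNeumannAlgebra.IsStarProjection.mem_iff isStarProjection_starProjection]
    intro y hy
    rw [Submodule.range_starProjection, Module.End.mem_invtSubmodule]
    intro ψ hψ
    refine map_mem_closure y.continuous hψ ?_
    rintro _ ⟨x, hx, rfl⟩
    exact ⟨y * x, mul_mem hy hx, rfl⟩
  have hΩ : Ω ∈ K := K₀.le_topologicalClosure ⟨1, one_mem _, rfl⟩
  have h0 := hsep (1 - K.starProjection) (sub_mem (one_mem _) hp) (by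
    rw [sub_apply, one_apply_eq_self, Submodule.starProjection_eq_self_iff.2 hΩ, sub_self])
  rw [Submodule.dense_iff_topologicalClosure_eq_top, eq_top_iff]
  rintro ψ -
  rw [← Submodule.starProjection_eq_self_iff (K := K), ← sub_eq_zero.1 h0, one_apply_eq_self]

end VonNeumann

/-! ### Twisted tensor products of Borchers triples -/

section Twist

variable {H : Type*} [NormedAddCommGroup H] [InnerProductSpace ℂ H] [CompleteSpace H]

theorem IsInnerSymmetry.conj_mem_commutant {M : VonNeumannAlgebra H} {T : Spacetime → H →L[ℂ] H}
    {Ω : H} {V : H →L[ℂ] H} (hV : IsInnerSymmetry M T Ω V) {x : H →L[ℂ] H}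
    (hx : x ∈ M.commutant) : V * x * star V ∈ M.commutant := by
  rw [VonNeumannAlgebra.mem_commutant_iff] at *
  intro g hg
  have h1 := Unitary.mul_star_self_of_mem hV.mem_unitary
  have h2 := Unitary.star_mul_self_of_mem hV.mem_unitary
  have hg' : star V * g * V ∈ M := by
    rw [hV.preserves]
    convert hg using 1
    calc V * (star V * g * V) * star V = (V * star V) * g * (V * star V) := by noncomm_ring
      _ = g := by rw [h1, one_mul, mul_one]
  calc g * (V * x * star V) = (V * star V) * g * V * x * star V := by rw [h1]; noncomm_ring
    _ = V * ((star V * g * V) * x) * star V := by noncomm_ring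
    _ = V * (x * (star V * g * V)) * star V := by rw [hx _ hg']
    _ = V * x * star V * g * (V * star V) := by noncomm_ring
    _ = V * x * star V * g := by rw [h1, mul_one]

theorem mem_twistedAlgebra_iff {M : VonNeumannAlgebra H}
    {W : HilbertTensor H →L[ℂ] HilbertTensor H} {z : HilbertTensor H →L[ℂ] HilbertTensor H} :
    z ∈ twistedAlgebra M W ↔ ∀ c, (∀ x ∈ M, opTensor x 1 * c = c * opTensor x 1) →
      (∀ y ∈ M, W * opTensor 1 y * star W * c = c * (W * opTensor 1 y * star W)) →
      c * z = z * c := by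
  rw [twistedAlgebra, mem_generatedVonNeumannAlgebra_iff]
  · refine forall_congr' fun c => ⟨fun h h1 h2 => h ?_, fun h h1 => h ?_ ?_⟩
    · rintro _ (⟨x, hx, rfl⟩ | ⟨y, hy, rfl⟩)
      exacts [h1 x hx, h2 y hy]
    · exact fun x hx => h1 _ (Or.inl ⟨x, hx, rfl⟩)
    · exact fun y hy => h1 _ (Or.inr ⟨y, hy, rfl⟩)
  · rintro _ (⟨x, hx, rfl⟩ | ⟨y, hy, rfl⟩)
    · exact Or.inl ⟨star x, star_mem hx, by rw [star_opTensor, star_one]⟩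
    · refine Or.inr ⟨star y, star_mem hy, ?_⟩
      rw [star_mul, star_mul, star_star, star_opTensor, star_one, mul_assoc]

variable {ι : Type*} (e : HilbertBasis ι ℂ H) {Y : ι → H →L[ℂ] H}
  {W : HilbertTensor H →L[ℂ] HilbertTensor H}

section

variable (hW : W ∈ unitary (HilbertTensor H →L[ℂ] HilbertTensor H))
  (hY : ∀ i, Y i ∈ unitary (H →L[ℂ] H))
include hW hY

/-- Conjugation of `x ⊗ 1` with `W = ∑ᵢ Yᵢ ⊗ |eᵢ⟩⟨eᵢ|`. -/
theorem conj_opTensor_left (hWl : ∀ ψ i, W (vecTensor ψ (e i)) = vecTensor (Y i ψ) (e i))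
    (x : H →L[ℂ] H) (ψ : H) (i : ι) : (W * opTensor x 1 * star W) (vecTensor ψ (e i)) =
      vecTensor ((Y i * x * star (Y i)) ψ) (e i) := by
  have h1 : star W (vecTensor ψ (e i)) = vecTensor (star (Y i) ψ) (e i) := by
    have h2 : W (vecTensor (star (Y i) ψ) (e i)) = vecTensor ψ (e i) := by
      rw [hWl, ← mul_apply_eq_comp, Unitary.mul_star_self_of_mem (hY i), one_apply_eq_self]
    rw [← h2, ← mul_apply_eq_comp, Unitary.star_mul_self_of_mem hW, one_apply_eq_self]
  simp only [mul_apply_eq_comp, h1, opTensor_vecTensor, one_apply_eq_self, hWl]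

/-- Conjugation of `1 ⊗ y` with `W = ∑ᵢ |eᵢ⟩⟨eᵢ| ⊗ Yᵢ`. -/
theorem conj_opTensor_right (hWr : ∀ i φ, W (vecTensor (e i) φ) = vecTensor (e i) (Y i φ))
    (y : H →L[ℂ] H) (i : ι) (φ : H) : (W * opTensor 1 y * star W) (vecTensor (e i) φ) =
      vecTensor (e i) ((Y i * y * star (Y i)) φ) := by
  have h1 : star W (vecTensor (e i) φ) = vecTensor (e i) (star (Y i) φ) := by
    have h2 : W (vecTensor (e i) (star (Y i) φ)) = vecTensor (e i) φ := by
      rw [hWr, ← mul_apply_eq_comp, Unitary.mul_star_self_of_mem (hY i), one_apply_eq_self]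
    rw [← h2, ← mul_apply_eq_comp, Unitary.star_mul_self_of_mem hW, one_apply_eq_self]
  simp only [mul_apply_eq_comp, h1, opTensor_vecTensor, one_apply_eq_self, hWr]

end

/-- A unitary which acts as `∑ᵢ Yᵢ ⊗ |eᵢ⟩⟨eᵢ|` and also as `∑ᵢ |eᵢ⟩⟨eᵢ| ⊗ Yᵢ`, with inner symmetries
`Yᵢ` and an orthonormal basis `e`, twists a Borchers triple to another one. The first form shows that
`W (x' ⊗ 1) W*` and the second one that `1 ⊗ y'` belongs to the commutant of the twisted algebra,
for `x', y' ∈ M'`, so that `Ω ⊗ Ω` is cyclic for the commutant. -/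
theorem isBorchersTriple_twistedAlgebra {M : VonNeumannAlgebra H} {T : Spacetime → H →L[ℂ] H}
    {Ω : H} (hB : IsBorchersTriple M T Ω) (hY : ∀ i, IsInnerSymmetry M T Ω (Y i))
    (hW : W ∈ unitary (HilbertTensor H →L[ℂ] HilbertTensor H))
    (hWl : ∀ ψ i, W (vecTensor ψ (e i)) = vecTensor (Y i ψ) (e i))
    (hWr : ∀ i φ, W (vecTensor (e i) φ) = vecTensor (e i) (Y i φ)) :
    IsBorchersTriple (twistedAlgebra M W) (fun a => opTensor (T a) (T a)) (vecTensor Ω Ω) := by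
  have hYu := fun i => (hY i).mem_unitary
  have hWW := Unitary.star_mul_self_of_mem hW
  -- `W` commutes with the translations
  have hWT : ∀ a, W * opTensor (T a) (T a) = opTensor (T a) (T a) * W := by
    intro a
    have h1 : W * opTensor (T a) 1 = opTensor (T a) 1 * W := clm_ext_right e fun ψ i => by
      simp only [mul_apply_eq_comp, opTensor_vecTensor, one_apply_eq_self, hWl]
      rw [← mul_apply_eq_comp, (hY i).commutes, mul_apply_eq_comp]
    have h2 : W * opTensor 1 (T a) = opTensor 1 (T a) * W := clm_ext_left e fun i φ => by
      simp only [mul_apply_eq_comp, opTensor_vecTensor, one_apply_eq_self, hWr]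
      rw [← mul_apply_eq_comp, (hY i).commutes, mul_apply_eq_comp]
    have h3 : opTensor (T a) (T a) = opTensor (T a) 1 * opTensor 1 (T a) := by
      rw [← opTensor_mul, one_mul, mul_one]
    rw [h3, ← mul_assoc, h1, mul_assoc, h2, mul_assoc]
  -- `W` and `W*` fix the vectors with one factor `Ω`
  have hWΩl : ∀ φ, W (vecTensor Ω φ) = vecTensor Ω φ := fun φ =>
    DFunLike.congr_fun (f := W ∘L vecTensorL H Ω) (g := vecTensorL H Ω) (e.clm_ext fun i => by
      change W (vecTensor Ω (e i)) = vecTensor Ω (e i)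
      rw [hWl, (hY i).fixes_vacuum]) φ
  have hWΩr : ∀ ψ, W (vecTensor ψ Ω) = vecTensor ψ Ω := fun ψ =>
    DFunLike.congr_fun (f := W ∘L (vecTensorL H).flip Ω) (g := (vecTensorL H).flip Ω)
      (e.clm_ext fun i => by
        change W (vecTensor (e i) Ω) = vecTensor (e i) Ω
        rw [hWr, (hY i).fixes_vacuum]) ψ
  have hWsΩ : star W (vecTensor Ω Ω) = vecTensor Ω Ω := by
    conv_lhs => rw [← hWΩl Ω]
    rw [← mul_apply_eq_comp, hWW, one_apply_eq_self]
  have hΩxy : ∀ x y : H →L[ℂ] H, (opTensor x 1 * (W * opTensor 1 y * star W)) (vecTensor Ω Ω) =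
      vecTensor (x Ω) (y Ω) := by
    intro x y
    simp only [mul_apply_eq_comp, hWsΩ, opTensor_vecTensor, one_apply_eq_self, hWΩl]
  have hΩyx : ∀ x y : H →L[ℂ] H, (opTensor 1 y * (W * opTensor x 1 * star W)) (vecTensor Ω Ω) =
      vecTensor (x Ω) (y Ω) := by
    intro x y
    simp only [mul_apply_eq_comp, hWsΩ, opTensor_vecTensor, one_apply_eq_self, hWΩr]
  have hgen₁ : ∀ x ∈ M, opTensor x 1 ∈ twistedAlgebra M W := fun x hx =>
    mem_twistedAlgebra_iff.2 fun c h1 _ => (h1 x hx).symm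
  have hgen₂ : ∀ y ∈ M, W * opTensor 1 y * star W ∈ twistedAlgebra M W := fun y hy =>
    mem_twistedAlgebra_iff.2 fun c _ h2 => (h2 y hy).symm
  -- elements of the commutant
  have hcomm₁ : ∀ x' ∈ M.commutant, ∀ z ∈ twistedAlgebra M W,
      W * opTensor x' 1 * star W * z = z * (W * opTensor x' 1 * star W) := by
    intro x' hx' z hz
    refine mem_twistedAlgebra_iff.1 hz _ (fun x hx => ?_) fun y _ => ?_
    · refine clm_ext_right e fun ψ i => ?_
      rw [mul_apply_eq_comp (opTensor x 1), mul_apply_eq_comp _ (opTensor x 1),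
        conj_opTensor_left e hW hYu hWl,
        opTensor_vecTensor, opTensor_vecTensor, one_apply_eq_self, conj_opTensor_left e hW hYu hWl,
        ← mul_apply_eq_comp, ← mul_apply_eq_comp (Y i * x' * star (Y i)) x,
        VonNeumannAlgebra.mem_commutant_iff.1 ((hY i).conj_mem_commutant hx') x hx]
    · have h : opTensor 1 y * opTensor x' 1 = opTensor x' 1 * opTensor 1 y := by
        rw [← opTensor_mul, ← opTensor_mul]
        simp only [one_mul, mul_one]
      calc W * opTensor 1 y * star W * (W * opTensor x' 1 * star W)
          = W * opTensor 1 y * (star W * W) * opTensor x' 1 * star W := by noncomm_ring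
        _ = W * (opTensor 1 y * opTensor x' 1) * star W := by rw [hWW]; noncomm_ring
        _ = W * opTensor x' 1 * (star W * W) * opTensor 1 y * star W := by
          rw [h, hWW]; noncomm_ring
        _ = W * opTensor x' 1 * star W * (W * opTensor 1 y * star W) := by noncomm_ring
  have hcomm₂ : ∀ y' ∈ M.commutant, ∀ z ∈ twistedAlgebra M W,
      opTensor 1 y' * z = z * opTensor 1 y' := by
    intro y' hy' z hz
    refine mem_twistedAlgebra_iff.1 hz _ (fun x _ => ?_) fun y hy => ?_
    · rw [← opTensor_mul, ← opTensor_mul]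
      simp only [one_mul, mul_one]
    · refine clm_ext_left e fun i φ => ?_
      rw [mul_apply_eq_comp (opTensor 1 y'), mul_apply_eq_comp _ (opTensor 1 y'),
        conj_opTensor_right e hW hYu hWr,
        opTensor_vecTensor, opTensor_vecTensor, one_apply_eq_self, conj_opTensor_right e hW hYu hWr,
        ← mul_apply_eq_comp, ← mul_apply_eq_comp y',
        VonNeumannAlgebra.mem_commutant_iff.1 hy' _ (((hY i).preserves y).1 hy)]
  refine ⟨hB.isUnitaryRep.opTensor, fun a ha z hz => ?_,
    jointSpectrum_opTensor_subset hB.isUnitaryRep hB.spectrum_condition, ?_, fun z hz hzΩ => ?_⟩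
  · -- conjugation of the commutant of the twisted algebra with `(T a ⊗ T a)*`
    set S := opTensor (T a) (T a) with hS
    have hSu : S ∈ unitary _ := hB.isUnitaryRep.opTensor.mem_unitary a
    have hS1 := Unitary.star_mul_self_of_mem hSu
    have hS2 := Unitary.mul_star_self_of_mem hSu
    have hSs : star S = opTensor (star (T a)) (star (T a)) := star_opTensor _ _
    have hT := Unitary.mul_star_self_of_mem (hB.isUnitaryRep.mem_unitary a)
    -- if `c` commutes with `S g S*` then `S* c S` commutes with `g`
    have key : ∀ g c : HilbertTensor H →L[ℂ] HilbertTensor H,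
        S * g * star S * c = c * (S * g * star S) → g * (star S * c * S) = star S * c * S * g := by
      intro g c h
      calc g * (star S * c * S) = (star S * S) * g * star S * c * S := by rw [hS1]; noncomm_ring
        _ = star S * (S * g * star S * c) * S := by noncomm_ring
        _ = star S * c * S * g * (star S * S) := by rw [h]; noncomm_ring
        _ = star S * c * S * g := by rw [hS1, mul_one]
    rw [mem_twistedAlgebra_iff]
    intro c h1 h2
    have hcz := mem_twistedAlgebra_iff.1 hz (star S * c * S) (fun x hx => key _ _ ?_)
      (fun y hy => key _ _ ?_)
    · calc c * (S * z * star S) = (S * star S) * c * S * z * star S := by rw [hS2]; noncomm_ring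
        _ = S * (star S * c * S * z) * star S := by noncomm_ring
        _ = S * z * star S * c * (S * star S) := by rw [hcz]; noncomm_ring
        _ = S * z * star S * c := by rw [hS2, mul_one]
    · rw [hSs, hS, ← opTensor_mul, ← opTensor_mul, mul_one, hT]
      exact h1 _ (hB.wedge_covariant a ha x hx)
    · have : S * (W * opTensor 1 y * star W) * star S =
          W * opTensor 1 (T a * y * star (T a)) * star W := by
        have h3 : star W * star S = star S * star W :=
          (star_mul S W).symm.trans ((congrArg star (hWT a).symm).trans (star_mul W S))
        calc S * (W * opTensor 1 y * star W) * star S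
            = (S * W) * opTensor 1 y * (star W * star S) := by noncomm_ring
          _ = W * (S * opTensor 1 y * star S) * star W := by
            rw [← hWT a, h3]; noncomm_ring
          _ = _ := by rw [hSs, hS, ← opTensor_mul, ← opTensor_mul, mul_one, hT]
      rw [this]
      exact h2 _ (hB.wedge_covariant a ha y hy)
  · let D : Submodule ℂ (HilbertTensor H) :=
      { carrier := {ψ | ∃ x ∈ twistedAlgebra M W, x (vecTensor Ω Ω) = ψ}
        add_mem' := by
          rintro _ _ ⟨x, hx, rfl⟩ ⟨y, hy, rfl⟩
          exact ⟨x + y, add_mem hx hy, rfl⟩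
        zero_mem' := ⟨0, zero_mem _, rfl⟩
        smul_mem' := by
          rintro c _ ⟨x, hx, rfl⟩
          exact ⟨c • x, (twistedAlgebra M W).toStarSubalgebra.smul_mem hx c, rfl⟩ }
    refine dense_of_vecTensor_mem hB.cyclic hB.cyclic D ?_
    rintro _ ⟨x, hx, rfl⟩ _ ⟨y, hy, rfl⟩
    exact ⟨_, mul_mem (hgen₁ x hx) (hgen₂ y hy), hΩxy x y⟩
  · have hd := VonNeumannAlgebra.dense_commutant_of_separating hB.separating
    have hker : Dense (LinearMap.ker z.toLinearMap : Set (HilbertTensor H)) := by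
      refine dense_of_vecTensor_mem hd hd _ ?_
      rintro _ ⟨x', hx', rfl⟩ _ ⟨y', hy', rfl⟩
      rw [LinearMap.mem_ker, ← hΩyx]
      change (z * (opTensor 1 y' * (W * opTensor x' 1 * star W))) (vecTensor Ω Ω) = 0
      rw [← mul_assoc, ← hcomm₂ y' hy' z hz, mul_assoc, ← hcomm₁ x' hx' z hz, ← mul_assoc,
        mul_apply_eq_comp, hzΩ, map_zero]
    ext ψ
    exact hker.induction (P := fun ψ => z ψ = 0) (fun ψ hψ => hψ)
      (isClosed_eq z.continuous continuous_const) ψ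

open Complex in
/-- The twist by `e^{isQ ⊗ Q}`, where `Q` generates a `2π`-periodic one-parameter group `U` for which
all `U (s n) = e^{i s n Q}`, `n ∈ ℤ`, are inner symmetries: since `Q` has integer spectrum,
`e^{isQ ⊗ Q}` acts as `e^{i s n Q}` on one tensor factor when the other one has weight `n`. -/
theorem isBorchersTriple_twistedAlgebra_expI {M : VonNeumannAlgebra H}
    {T : Spacetime → H →L[ℂ] H} {Ω : H} (hB : IsBorchersTriple M T Ω) {U : ℝ → H →L[ℂ] H}
    (hU : IsUnitaryRep U) (hper : U (2 * Real.pi) = 1) (s : ℝ)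
    (hinner : ∀ n : ℤ, IsInnerSymmetry M T Ω (U (s * n))) :
    IsBorchersTriple
      (twistedAlgebra M (expI (pmapTensor (oneParamGenerator U) (oneParamGenerator U)) s))
      (fun a => opTensor (T a) (T a)) (vecTensor Ω Ω) := by
  obtain ⟨w, e, he⟩ := exists_weight_basis hU hper
  obtain ⟨hW, hWe⟩ := expI_pmapTensor e hU he
  refine isBorchersTriple_twistedAlgebra e hB (fun i => hinner i.1) (hW.mem_unitary s) (fun ψ i => ?_)
    (fun i φ => ?_)
  · refine DFunLike.congr_fun
      (f := expI (pmapTensor (oneParamGenerator U) (oneParamGenerator U)) s ∘L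
        (vecTensorL H).flip (e i))
      (g := (vecTensorL H).flip (e i) ∘L U (s * i.1)) (e.clm_ext fun j => ?_) ψ
    change expI _ s (vecTensor (e j) (e i)) = vecTensor (U (s * i.1) (e j)) (e i)
    rw [hWe, he, vecTensor_smul_left]
    push_cast
    ring_nf
  · refine DFunLike.congr_fun
      (f := expI (pmapTensor (oneParamGenerator U) (oneParamGenerator U)) s ∘L vecTensorL H (e i))
      (g := vecTensorL H (e i) ∘L U (s * i.1)) (e.clm_ext fun j => ?_) φ
    change expI _ s (vecTensor (e i) (e j)) = vecTensor (e i) (U (s * i.1) (e j))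
    rw [hWe, he, vecTensor_smul_right]
    push_cast
    ring_nf

end Twist

end

theorem theorem3p3 {H : Type*} [NormedAddCommGroup H] [InnerProductSpace ℂ H] [CompleteSpace H]
    (M : VonNeumannAlgebra H) (T : Spacetime → H →L[ℂ] H) (Ω : H)
    (hB : IsBorchersTriple M T Ω) :
    -- actions of the circle group `ℝ/ℤ`, with `V κ = e^{i 2π κ Q}`
    (∀ V : AddCircle (1 : ℝ) → H →L[ℂ] H, IsUnitaryRep V →
      (∀ s, IsInnerSymmetry M T Ω (V s)) →
      ∀ Q : H →ₗ.[ℂ] H,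
        Q = oneParamGenerator (fun t : ℝ => V ((t / (2 * Real.pi) : ℝ) : AddCircle (1 : ℝ))) →
      ∀ κ : ℝ,
        IsBorchersTriple (twistedAlgebra M (expI (pmapTensor Q Q) (2 * Real.pi * κ)))
          (fun a => opTensor (T a) (T a)) (vecTensor Ω Ω)) ∧
    -- actions of `ℤ/Nℤ`, with `V k = e^{i (2π k / N) Q}` for any choice of `Q`;
    -- here `U t = e^{itQ}` is the one-parameter unitary group generated by `Q`
    (∀ (N : ℕ), 0 < N → ∀ V : ZMod N → H →L[ℂ] H, IsUnitaryRep V →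
      (∀ s, IsInnerSymmetry M T Ω (V s)) →
      ∀ U : ℝ → H →L[ℂ] H, IsUnitaryRep U →
      (∀ k : ℤ, V (k : ZMod N) = U (2 * Real.pi * k / N)) →
      ∀ Q : H →ₗ.[ℂ] H, Q = oneParamGenerator U →
      ∀ k : ℤ,
        IsBorchersTriple (twistedAlgebra M (expI (pmapTensor Q Q) (2 * Real.pi * k / N)))
          (fun a => opTensor (T a) (T a)) (vecTensor Ω Ω)) ∧
    -- invariance of the vacuum vector is inherited as well
    ((∀ a, T a Ω = Ω) → ∀ a, opTensor (T a) (T a) (vecTensor Ω Ω) = vecTensor Ω Ω) := by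
  refine ⟨?_, ?_, fun hΩ a => by rw [opTensor_vecTensor, hΩ]⟩
  · rintro V hV hinner Q rfl κ
    have hpi := Real.two_pi_pos.ne'
    refine isBorchersTriple_twistedAlgebra_expI hB (U := fun t : ℝ =>
      V ((t / (2 * Real.pi) : ℝ) : AddCircle (1 : ℝ))) ⟨fun t => hV.mem_unitary _, fun s t => ?_,
        fun ψ => ?_⟩ ?_ _ fun n => hinner _
    · simp only [add_div, AddCircle.coe_add, hV.map_add]
    · exact (hV.strongly_continuous ψ).comp
        ((AddCircle.continuous_mk' 1).comp (continuous_id.div_const _))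
    · simp only [div_self hpi, AddCircle.coe_period, hV.map_zero]
  · rintro N hN V hV hinner U hU hVU Q rfl k
    have hN' : (N : ℝ) ≠ 0 := by exact_mod_cast hN.ne'
    refine isBorchersTriple_twistedAlgebra_expI hB hU ?_ _ fun n => ?_
    · have h := hVU N
      rw [Int.cast_natCast, Int.cast_natCast, mul_div_assoc, div_self hN', mul_one,
        ZMod.natCast_self, hV.map_zero] at h
      exact h.symm
    · have h := hVU (k * n)
      rw [show 2 * Real.pi * ((k * n : ℤ) : ℝ) / N = 2 * Real.pi * k / N * n by
        push_cast; ring] at h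
      rw [← h]
      exact hinner _
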